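/- **Setting.** Let $k\ge 1$ and let $\mathcal F(1),\dots,\mathcal F(k)$ be probability distributions supported in $[0,1]$ with means $\theta(1),\dots,\theta(k)$ (a purely stochastic bandit). Write $\theta^\star=\max_a\theta(a)$ and $\Delta(a)=\theta^\star-\theta(a)$. In each round $t=1,\dots,T$ the learner chooses a distribution $p^t$ on the arms $[k]$, rewards $r^t(a)\sim\mathcal F(a)$ are drawn independently of the past, the learner draws $a^t\sim p^t$ (conditionally on the past, independently of the rewards of round $t$) and observes only $r^t(a^t)$. The pseudo-regret is $$\mathsf{Reg}=\max_{a\in[k]}\mathbf E\Big[\sum_{t=1}^T r^t(a)-r^t(a^t)\Big].$$ **AAEAS** (with parameter $\delta$). Start with the active set $\mathcal A=[k]$, $R(a)=0$ for all $a$, and $S=0$. In each round draw $a^t$ uniformly from $\mathcal A$, add $r^t(a^t)$ to $S$ and to $R(a^t)$, and then remove from $\mathcal A$ all $a'$ with $R(a')+\mathrm{CB}(S)<\max_{a\in\mathcal A}R(a)$, where $$\mathrm{CB}(S)=2\sqrt{\max\big(4S\log(2/\delta'),\,16k\log^2(2/\delta')\big)},\qquad \delta'=\frac{\delta}{(k+1)T}.$$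 **BROAD** (online mirror descent with log-barrier and doubling, with initial learning rate $\eta_0\in(0,1)$). Start with $\eta=\eta_0$ and $p^1$ uniform. After round $t$, let $\widehat r^{\,t}(a)=\frac{r^t(a)}{p^t(a)}\mathbf 1[a=a^t]$ and let $t_R$ be the first round after the last restart ($t_R=1$ before the first restart). If $$\sum_{\tau=t_R}^{t}\sum_{a=1}^k p^\tau(a)^2\big(\widehat r^{\,\tau}(a)-r^\tau(a^\tau)\big)^2\ \ge\ \frac{k\ln T}{3\eta^2},$$ then halve $\eta$ and restart, i.e. let $p^{t+1}$ be uniform and $t_R=t+1$. Otherwise let $$p^{t+1}(a^t)=\frac{p^t(a^t)}{1-\eta\, r^t(a^t)+\gamma\, p^t(a^t)},\qquad p^{t+1}(a)=\frac{p^t(a)}{1+\gamma\, p^t(a)}\quad(a\ne a^t),$$ where $\gamma\ge 0$ is the number for which $p^{t+1}$ is a probability distribution. **Corollary (small means).** Fix $k$. 1. There is a constant $C$ that depends only on $k$ such that for all $T\ge2$ and every stochastic bandit as above, AAEAS run with $\delta=1/T$ satisfies $$\mathsf{Reg}\ \le\ C\,\cdot\,\max_a\theta(a)\,\cdot\sum_{a:\,\Delta(a)>0}\frac{\log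 T}{\Delta(a)}.$$ 2. For every $\eta_0\in(0,1)$ there is a constant $C$ that depends only on $k$ and $\eta_0$ such that for all $T\ge2$ and every stochastic bandit as above whose best arm is unique, BROAD with initial learning rate $\eta_0$ satisfies the same bound. -/

import Mathlib

open MeasureTheory ProbabilityTheory

noncomputable section

/-- A purely stochastic bandit with `k` arms: one reward distribution for each arm,
supported in `[0,1]`. -/
structure StochasticBandit (k : ℕ) where
  dist : Fin k → ProbabilityMeasure ℝ
  supported : ∀ a, ∀ᵐ x ∂(dist a : Measure ℝ), x ∈ Set.Icc (0 : ℝ) 1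

namespace StochasticBandit

variable {k : ℕ} (B : StochasticBandit k)

/-- The mean reward `θ(a)`. -/
def mean (a : Fin k) : ℝ := ∫ x, x ∂(B.dist a : Measure ℝ)

/-- The largest mean `max_a θ(a)`. -/
def bestMean : ℝ := ⨆ a, B.mean a

/-- The gap `Δ(a) = max_b θ(b) - θ(a)`. -/
def gap (a : Fin k) : ℝ := B.bestMean - B.mean a

end StochasticBandit

/-- A (randomized) learner for `k` arms. In every round it draws an arm with the probabilities
`prob s` that its current state `s` prescribes, observes the reward of that arm (and nothing else)
and updates its state. -/
structure BanditAlgorithm (k : ℕ) where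
  State : Type
  init : State
  prob : State → Fin k → ℝ
  update : State → Fin k → ℝ → State

/-- State of the learner at the beginning of round `t` (rounds are numbered `0, 1, 2, …`), when
the arms `A 0, A 1, …` are pulled and `r s a` is the reward of arm `a` in round `s`. -/
def BanditAlgorithm.stateAt {k : ℕ} (alg : BanditAlgorithm k) {Ω : Type*}
    (r : ℕ → Fin k → Ω → ℝ) (A : ℕ → Ω → Fin k) : ℕ → Ω → alg.State
  | 0, _ => alg.init
  | t + 1, ω => alg.update (alg.stateAt r A t ω) (A t ω) (r t (A t ω) ω)

/-- The σ-algebra generated by the rewards of all arms in round `t`. -/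
abbrev rewardSigma {k : ℕ} {Ω : Type*} (r : ℕ → Fin k → Ω → ℝ) (t : ℕ) : MeasurableSpace Ω :=
  MeasurableSpace.comap (fun ω a => r t a ω) (inferInstance : MeasurableSpace (Fin k → ℝ))

/-- The σ-algebra generated by everything (pulled arms, rewards of all arms) that happens
before round `t`. -/
abbrev pastSigma {k : ℕ} {Ω : Type*} (r : ℕ → Fin k → Ω → ℝ) (A : ℕ → Ω → Fin k) (t : ℕ) :
    MeasurableSpace Ω :=
  ⨆ (s : ℕ) (_ : s < t), (rewardSigma r s ⊔ MeasurableSpace.comap (A s) ⊤)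

/-- `r` (rewards) and `A` (pulled arms) are a run of the learner `alg` on the stochastic bandit
`B` for `T` rounds: in each round `t < T`, the rewards `r t a` are drawn from the
distributions of the arms, independently of the past, and the arm `A t` is drawn from the
distribution that the learner prescribes after its observations of the earlier rounds. -/
structure IsRun {k : ℕ} {Ω : Type*} [MeasurableSpace Ω] (P : Measure Ω)
    (B : StochasticBandit k) (alg : BanditAlgorithm k) (T : ℕ)
    (r : ℕ → Fin k → Ω → ℝ) (A : ℕ → Ω → Fin k) : Prop where
  measurable_reward : ∀ t a, Measurable (r t a)
  measurable_arm : ∀ t, Measurable (A t)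
  law_reward : ∀ t < T, ∀ a, P.map (r t a) = (B.dist a : Measure ℝ)
  indep_past : ∀ t < T, Indep (rewardSigma r t) (pastSigma r A t) P
  law_arm : ∀ t < T, ∀ a,
    P[Set.indicator {ω | A t ω = a} (fun _ => (1 : ℝ)) | pastSigma r A t ⊔ rewardSigma r t]
      =ᵐ[P] fun ω => alg.prob (alg.stateAt r A t ω) a

/-- Pseudo-regret after `T` rounds: `max_a E[∑_{t<T} (r^t(a) - r^t(a^t))]`. -/
def pseudoRegret {k : ℕ} {Ω : Type*} [MeasurableSpace Ω] (P : Measure Ω) (T : ℕ)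
    (r : ℕ → Fin k → Ω → ℝ) (A : ℕ → Ω → Fin k) : ℝ :=
  ⨆ a : Fin k, ∫ ω, ∑ t ∈ Finset.range T, (r t a ω - r t (A t ω) ω) ∂P

/-! ### Active arm elimination with adversarial scaling -/

/-- State of AAEAS: active arms, reward collected from each arm, total reward collected. -/
structure AAEASState (k : ℕ) where
  active : Finset (Fin k)
  R : Fin k → ℝ
  S : ℝ

/-- The confidence bound `CB(S)` with failure probability `δ'`. -/
def confidenceBound (k : ℕ) (δ' S : ℝ) : ℝ :=
  2 * Real.sqrt (max (4 * S * Real.log (2 / δ')) (16 * (k : ℝ) * Real.log (2 / δ') ^ 2))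

open Classical in
/-- AAEAS with `k` arms, horizon `T` and failure probability `δ`. -/
def AAEAS (k T : ℕ) (δ : ℝ) : BanditAlgorithm k where
  State := AAEASState k
  init := { active := Finset.univ, R := fun _ => 0, S := 0 }
  prob s a := if a ∈ s.active then 1 / (s.active.card : ℝ) else 0
  update s a x :=
    let S' := s.S + x
    let R' := Function.update s.R a (s.R a + x)
    let CB := confidenceBound k (δ / (((k : ℝ) + 1) * T)) S'
    { active := s.active.filter fun b => ¬ ∃ c ∈ s.active, R' b + CB < R' c
      R := R'
      S := S' }

/-! ### Online mirror descent with log-barrier and doubling -/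

/-- One log-barrier mirror descent step from `p` with learning rate `η`, after reward `x` of
the pulled arm `a`, with normalization parameter `γ`. -/
def logBarrierUpdate {k : ℕ} (p : Fin k → ℝ) (η : ℝ) (a : Fin k) (x γ : ℝ) (b : Fin k) : ℝ :=
  p b / (1 - (if b = a then η * x else 0) + γ * p b)

/-- The normalization `γ ≥ 0` for which the updated weights sum to one. It exists and is unique
for positive `p` (see `existsUnique_normalizer`); `sInf` picks the only element. -/
def normalizer {k : ℕ} (p : Fin k → ℝ) (η : ℝ) (a : Fin k) (x : ℝ) : ℝ :=
  sInf {γ : ℝ | 0 ≤ γ ∧ ∑ b, logBarrierUpdate p η a x γ b = 1}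

theorem existsUnique_normalizer {k : ℕ} (p : Fin k → ℝ) (hp : ∀ b, 0 < p b)
    (hsum : ∑ b, p b = 1) (η : ℝ) (a : Fin k) (x : ℝ) (h0 : 0 ≤ η * x) (h1 : η * x < 1) :
    ∃! γ : ℝ, 0 ≤ γ ∧ ∑ b, logBarrierUpdate p η a x γ b = 1 := by
  have hc : ∀ b, 0 < 1 - (if b = a then η * x else 0) ∧
      1 - (if b = a then η * x else 0) ≤ 1 := by
    intro b
    split_ifs <;> constructor <;> linarith
  have hden : ∀ b, ∀ γ : ℝ, 0 ≤ γ → 0 < 1 - (if b = a then η * x else 0) + γ * p b := by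
    intro b γ hγ
    have := mul_nonneg hγ (hp b).le
    linarith [(hc b).1]
  have hne : (Finset.univ : Finset (Fin k)).Nonempty := ⟨a, Finset.mem_univ a⟩
  have hanti : ∀ γ₁ γ₂ : ℝ, 0 ≤ γ₁ → γ₁ < γ₂ →
      ∑ b, logBarrierUpdate p η a x γ₂ b < ∑ b, logBarrierUpdate p η a x γ₁ b := by
    intro γ₁ γ₂ hγ hlt
    refine Finset.sum_lt_sum_of_nonempty hne fun b _ => ?_
    unfold logBarrierUpdate
    refine div_lt_div_of_pos_left (hp b) (hden b γ₁ hγ) ?_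
    have := mul_lt_mul_of_pos_right hlt (hp b)
    linarith
  have hk : (0 : ℝ) < k := by
    have : 0 < k := a.pos
    exact_mod_cast this
  have hcont : ContinuousOn (fun γ : ℝ => ∑ b, logBarrierUpdate p η a x γ b)
      (Set.Icc (0 : ℝ) k) := by
    refine continuousOn_finsetSum _ fun b _ => ?_
    unfold logBarrierUpdate
    refine ContinuousOn.div continuousOn_const (by fun_prop) ?_
    intro γ hγ
    exact (hden b γ hγ.1).ne'
  have hleft : 1 ≤ ∑ b, logBarrierUpdate p η a x 0 b := by
    rw [← hsum]
    refine Finset.sum_le_sum fun b _ => ?_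
    unfold logBarrierUpdate
    rw [le_div_iff₀ (hden b 0 le_rfl)]
    nlinarith [hp b, (hc b).2]
  have hright : ∑ b, logBarrierUpdate p η a x k b ≤ 1 := by
    calc ∑ b, logBarrierUpdate p η a x k b ≤ ∑ _b : Fin k, 1 / (k : ℝ) := by
          refine Finset.sum_le_sum fun b _ => ?_
          unfold logBarrierUpdate
          rw [div_le_div_iff₀ (hden b k hk.le) hk]
          nlinarith [(hc b).1]
      _ = 1 := by
          simp [hk.ne']
  obtain ⟨γ, hγ, hγ1⟩ := intermediate_value_Icc' hk.le hcont ⟨hright, hleft⟩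
  refine ⟨γ, ⟨hγ.1, hγ1⟩, ?_⟩
  rintro γ' ⟨h0', h1'⟩
  simp only at hγ1
  rcases lt_trichotomy γ' γ with h | h | h
  · have := hanti γ' γ h0' h
    linarith
  · exact h
  · have := hanti γ γ' hγ.1 h
    linarith

/-- State of BROAD: current distribution, current learning rate, and the sum
`∑_τ ∑_a p^τ(a)² (r̂^τ(a) - r^τ(a^τ))²` over the rounds since the last restart. -/
structure BROADState (k : ℕ) where
  p : Fin k → ℝ
  η : ℝ
  V : ℝ

/-- The importance sampling estimator, after reward `x` of the pulled arm `a`. -/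
def rewardEstimate {k : ℕ} (p : Fin k → ℝ) (a : Fin k) (x : ℝ) (b : Fin k) : ℝ :=
  if b = a then x / p b else 0

open Classical in
/-- BROAD (log-barrier mirror descent that halves the learning rate and restarts) with `k`
arms, horizon `T` and initial learning rate `η₀`. -/
def BROAD (k T : ℕ) (η₀ : ℝ) : BanditAlgorithm k where
  State := BROADState k
  init := { p := fun _ => 1 / (k : ℝ), η := η₀, V := 0 }
  prob s a := s.p a
  update s a x :=
    let V' := s.V + ∑ b, s.p b ^ 2 * (rewardEstimate s.p a x b - x) ^ 2
    if V' ≥ k * Real.log T / (3 * s.η ^ 2) then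
      { p := fun _ => 1 / (k : ℝ), η := s.η / 2, V := 0 }
    else
      { p := logBarrierUpdate s.p s.η a x (normalizer s.p s.η a x), η := s.η, V := V' }

end

/-! Both bounds are first-order: the noise is measured by the rewards collected, so the bound scales
with the best mean `θ*`. By `IsRun.pseudoRegret_le` it suffices to control `X`, the expected sum
over rounds of `∑ p(a) Δ(a)`. Rewards are clipped to `[0,1]`. This changes them only on a null set,
and it makes all invariants of the states hold at every sample point. `IsRun.integral_round`
integrates out one round given the past.

BROAD. Take the potential `logBarrierDiv u p / η`, with `u` a slightly smoothed best arm. One mirror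
descent step pays at most `η² · estimateVar / (1 - η₀)` (`logBarrierDiv_step`). Restarts double the
price geometrically, so pathwise, for every `μ > 0`, the estimated regret is at most a constant
times `Q/η₀ + μ V + 3 Q/μ`, with `Q = k log T` and `V` the total variance (`estimatedRegret_le`).
This is linear in `V`, so expectations can be taken. As `x² ≤ x` for a reward `x`, the variance is
linear in the rewards, and its mean is at most `4 θ* ∑ (1 - E p(c))` with `c` the best arm
(`broad_integral_totalVar`). Since `c` is the only best arm, `Δ_min ∑ (1 - E p(c)) ≤ X`. For `μ` of
order `Δ_min/θ*` the variance term is at most `X/2` and is absorbed, which leaves `X ≲ θ* log T /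
Δ_min`.

AAEAS. Let `c` be a best arm and `W` the sum of the inverse sizes of the active sets. While `b` and
`c` are both active, `exp (λ (R b - R c + Δ(b) W) - λ² S)` is a supermartingale, because a reward in
`[0,1]` has variance at most its mean (`exp_bernstein_le`, `integral_aaeas_exp_succ_le`). A union
bound over rounds, arms and a grid of `λ` gives `R b - R c + Δ(b) W < CB(S)` with high probability.
Hence `c` is never removed, and an arm `b` that survives has `Δ(b) W < 2 CB(S)`. Since `S ≲ θ* t +
log T` and `t ≤ k W`, this can be solved for `W` (`elimination_arith`). It bounds the total
probability of `b` by order `θ* log T / Δ(b)²`. The exceptional event has probability at most `1/T`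
and costs at most `θ*`. -/

noncomputable section

/-! ### Runs of a bandit algorithm with clipped rewards -/

/-- Projection of the real line onto `[0,1]`. -/
def clip01 (x : ℝ) : ℝ := max 0 (min x 1)

lemma clip01_mem (x : ℝ) : clip01 x ∈ Set.Icc (0 : ℝ) 1 :=
  ⟨le_max_left _ _, max_le zero_le_one (min_le_right _ _)⟩

lemma clip01_nonneg (x : ℝ) : 0 ≤ clip01 x := (clip01_mem x).1

lemma clip01_le_one (x : ℝ) : clip01 x ≤ 1 := (clip01_mem x).2

lemma clip01_of_mem {x : ℝ} (hx : x ∈ Set.Icc (0 : ℝ) 1) : clip01 x = x := by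
  rw [clip01, min_eq_left hx.2, max_eq_right hx.1]

lemma measurable_clip01 : Measurable clip01 := by
  unfold clip01
  fun_prop

/-- Rewards projected onto `[0,1]`. -/
def clippedReward {k : ℕ} {Ω : Type*} (r : ℕ → Fin k → Ω → ℝ) (t : ℕ) (a : Fin k) (ω : Ω) : ℝ :=
  clip01 (r t a ω)

lemma clippedReward_nonneg {k : ℕ} {Ω : Type*} (r : ℕ → Fin k → Ω → ℝ) (t : ℕ) (a : Fin k)
    (ω : Ω) : 0 ≤ clippedReward r t a ω := clip01_nonneg _

lemma clippedReward_le_one {k : ℕ} {Ω : Type*} (r : ℕ → Fin k → Ω → ℝ) (t : ℕ) (a : Fin k)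
    (ω : Ω) : clippedReward r t a ω ≤ 1 := clip01_le_one _

/-! ### Measurability with respect to the past. -/

section Past

variable {k : ℕ} {Ω : Type*} {r : ℕ → Fin k → Ω → ℝ} {A : ℕ → Ω → Fin k}

lemma pastSigma_mono {s t : ℕ} (h : s ≤ t) : pastSigma r A s ≤ pastSigma r A t :=
  iSup₂_le fun u hu => le_iSup₂_of_le u (hu.trans_le h) le_rfl

lemma rewardSigma_le_pastSigma (t : ℕ) : rewardSigma r t ≤ pastSigma r A (t + 1) :=
  le_iSup₂_of_le t (Nat.lt_succ_self t) le_sup_left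

lemma measurable_arm_past (t : ℕ) : Measurable[pastSigma r A (t + 1)] (A t) := by
  have h : MeasurableSpace.comap (A t) ⊤ ≤ pastSigma r A (t + 1) :=
    le_iSup₂_of_le t (Nat.lt_succ_self t) le_sup_right
  exact (comap_measurable (A t)).mono h le_rfl

lemma measurable_reward_rewardSigma (t : ℕ) (a : Fin k) : Measurable[rewardSigma r t] (r t a) := by
  have h : Measurable[rewardSigma r t] (fun ω a => r t a ω) := comap_measurable _
  exact (measurable_pi_apply a).comp h

lemma measurable_select {m : MeasurableSpace Ω} {a : Ω → Fin k} {f : Fin k → Ω → ℝ}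
    (ha : Measurable a) (hf : ∀ b, Measurable (f b)) : Measurable fun ω => f (a ω) ω := by
  have h : (fun ω => f (a ω) ω) = fun ω => ∑ b, if a ω = b then f b ω else 0 := by
    funext ω
    simp
  rw [h]
  exact Finset.measurable_sum _ fun b _ =>
    Measurable.ite (ha (measurableSet_singleton b)) (hf b) measurable_const

lemma measurable_clippedReward_past (t : ℕ) (a : Fin k) :
    Measurable[pastSigma r A (t + 1)] (clippedReward r t a) :=
  measurable_clip01.comp
    ((measurable_reward_rewardSigma t a).mono (rewardSigma_le_pastSigma t) le_rfl)

lemma measurable_playedReward_past (t : ℕ) :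
    Measurable[pastSigma r A (t + 1)] (fun ω => clippedReward r t (A t ω) ω) :=
  measurable_select (measurable_arm_past t) (measurable_clippedReward_past t)

end Past

/-! ### Elementary bounds for means and gaps. -/

namespace StochasticBandit

variable {k : ℕ} (B : StochasticBandit k)

lemma integrable_of_bounded (a : Fin k) {f : ℝ → ℝ} (hf : Measurable f) {K : ℝ}
    (hK : ∀ x ∈ Set.Icc (0 : ℝ) 1, |f x| ≤ K) : Integrable f (B.dist a : Measure ℝ) :=
  Integrable.of_bound hf.aestronglyMeasurable K
    ((B.supported a).mono fun x hx => by simpa using hK x hx)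

lemma integrable_id (a : Fin k) : Integrable (fun x : ℝ => x) (B.dist a : Measure ℝ) :=
  B.integrable_of_bounded a measurable_id (K := 1) fun x hx => abs_le.2 ⟨by linarith [hx.1], hx.2⟩

lemma mean_nonneg (a : Fin k) : 0 ≤ B.mean a :=
  integral_nonneg_of_ae ((B.supported a).mono fun _ hx => hx.1)

lemma mean_le_one (a : Fin k) : B.mean a ≤ 1 := by
  have h := integral_mono_ae (B.integrable_id a) (integrable_const (1 : ℝ))
    ((B.supported a).mono fun _ hx => hx.2)
  simpa [mean] using h

lemma mean_le_bestMean (a : Fin k) : B.mean a ≤ B.bestMean :=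
  le_ciSup (f := B.mean) (Set.finite_range _).bddAbove a

lemma gap_nonneg (a : Fin k) : 0 ≤ B.gap a := sub_nonneg.2 (B.mean_le_bestMean a)

lemma gap_le_bestMean (a : Fin k) : B.gap a ≤ B.bestMean := by
  have := B.mean_nonneg a
  unfold gap
  linarith

lemma exists_mean_eq_bestMean (hk : 0 < k) : ∃ a, B.mean a = B.bestMean := by
  have : Nonempty (Fin k) := ⟨⟨0, hk⟩⟩
  exact exists_eq_ciSup_of_finite

lemma bestMean_le_one (hk : 0 < k) : B.bestMean ≤ 1 := by
  obtain ⟨a, ha⟩ := B.exists_mean_eq_bestMean hk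
  exact ha ▸ B.mean_le_one a

lemma bestMean_nonneg (hk : 0 < k) : 0 ≤ B.bestMean := by
  obtain ⟨a, ha⟩ := B.exists_mean_eq_bestMean hk
  exact ha ▸ B.mean_nonneg a

end StochasticBandit

/-! ### Clipping the rewards and integrating out one round. -/

namespace IsRun

variable {k : ℕ} {Ω : Type*} [mΩ : MeasurableSpace Ω] {P : Measure Ω}
  {B : StochasticBandit k} {alg : BanditAlgorithm k} {T : ℕ}
  {r : ℕ → Fin k → Ω → ℝ} {A : ℕ → Ω → Fin k}

lemma rewardSigma_le (h : IsRun P B alg T r A) (t : ℕ) :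
    rewardSigma r t ≤ mΩ :=
  (measurable_pi_lambda _ (h.measurable_reward t)).comap_le

lemma pastSigma_le (h : IsRun P B alg T r A) (t : ℕ) :
    pastSigma r A t ≤ mΩ :=
  iSup₂_le fun s _ => sup_le (h.rewardSigma_le s) (h.measurable_arm s).comap_le

lemma measurable_clippedReward (h : IsRun P B alg T r A) (t : ℕ) (a : Fin k) :
    Measurable (clippedReward r t a) :=
  measurable_clip01.comp (h.measurable_reward t a)

lemma measurable_playedReward (h : IsRun P B alg T r A) (t : ℕ) :
    Measurable fun ω => clippedReward r t (A t ω) ω :=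
  (measurable_playedReward_past t).mono (h.pastSigma_le (t + 1)) le_rfl

lemma ae_clippedReward_eq (h : IsRun P B alg T r A) :
    ∀ᵐ ω ∂P, ∀ t < T, ∀ a, clippedReward r t a ω = r t a ω := by
  rw [ae_all_iff]
  intro t
  by_cases ht : t < T
  swap
  · exact .of_forall fun ω h => absurd h ht
  have : ∀ᵐ ω ∂P, ∀ a, clippedReward r t a ω = r t a ω := by
    rw [ae_all_iff]
    intro a
    have h1 := B.supported a
    rw [← h.law_reward t ht a] at h1
    exact (ae_of_ae_map (h.measurable_reward t a).aemeasurable h1).mono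
      fun ω hω => clip01_of_mem hω
  exact this.mono fun ω hω _ => hω

lemma integral_clippedReward (h : IsRun P B alg T r A) {t : ℕ} (ht : t < T) (a : Fin k) :
    ∫ ω, clippedReward r t a ω ∂P = B.mean a := by
  rw [StochasticBandit.mean, ← h.law_reward t ht a,
    integral_map (h.measurable_reward t a).aemeasurable
      (f := fun x : ℝ => x) measurable_id.aestronglyMeasurable]
  refine integral_congr_ae ?_
  filter_upwards [h.ae_clippedReward_eq] with ω hω
  rw [hω t ht a]

lemma stateAt_congr {Ω : Type*} (alg : BanditAlgorithm k) {r r' : ℕ → Fin k → Ω → ℝ}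
    {A : ℕ → Ω → Fin k} {ω : Ω} {T : ℕ} (h : ∀ t < T, ∀ a, r t a ω = r' t a ω) :
    ∀ t ≤ T, alg.stateAt r A t ω = alg.stateAt r' A t ω
  | 0, _ => rfl
  | t + 1, ht => by
    simp only [BanditAlgorithm.stateAt]
    rw [stateAt_congr alg h t (by omega), h t (by omega)]

lemma ae_stateAt_eq (h : IsRun P B alg T r A) :
    ∀ᵐ ω ∂P, ∀ t ≤ T, alg.stateAt (clippedReward r) A t ω = alg.stateAt r A t ω :=
  h.ae_clippedReward_eq.mono fun _ hω => stateAt_congr alg hω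

/-- Integrating out one round: given the past, the arm has the prescribed distribution and its
reward is an independent sample from the distribution of the arm. -/
lemma integral_round_arm [IsProbabilityMeasure P] (h : IsRun P B alg T r A) {t : ℕ} (ht : t < T)
    (a : Fin k)
    (hp : Measurable[pastSigma r A t] fun ω => alg.prob (alg.stateAt (clippedReward r) A t ω) a)
    {g : Ω → ℝ} (hg : Measurable[pastSigma r A t] g) {K : ℝ} (hgK : ∀ ω, |g ω| ≤ K)
    {f : ℝ → ℝ} (hf : Measurable f) {M : ℝ} (hfM : ∀ x ∈ Set.Icc (0 : ℝ) 1, |f x| ≤ M) :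
    ∫ ω, (g ω * f (clippedReward r t a ω)) * Set.indicator {ω | A t ω = a} (fun _ => (1 : ℝ)) ω ∂P
      = (∫ ω, g ω * alg.prob (alg.stateAt (clippedReward r) A t ω) a ∂P)
        * ∫ x, f x ∂(B.dist a : Measure ℝ) := by
  have hm'0 : pastSigma r A t ⊔ rewardSigma r t ≤ mΩ :=
    sup_le (h.pastSigma_le t) (h.rewardSigma_le t)
  have hfr : Measurable[rewardSigma r t] fun ω => f (clippedReward r t a ω) :=
    hf.comp (measurable_clip01.comp (measurable_reward_rewardSigma t a))
  have hg' : Measurable[pastSigma r A t ⊔ rewardSigma r t] g := hg.mono le_sup_left le_rfl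
  have hfr' : Measurable[pastSigma r A t ⊔ rewardSigma r t] fun ω => f (clippedReward r t a ω) :=
    hfr.mono le_sup_right le_rfl
  have hφ : StronglyMeasurable[pastSigma r A t ⊔ rewardSigma r t]
      fun ω => g ω * f (clippedReward r t a ω) := (Measurable.mul hg' hfr').stronglyMeasurable
  have hset : MeasurableSet {ω | A t ω = a} := h.measurable_arm t (measurableSet_singleton a)
  have hind : Integrable (Set.indicator {ω | A t ω = a} (fun _ => (1 : ℝ))) P :=
    (integrable_const 1).indicator hset
  have hK : 0 ≤ K := by
    have := nonempty_of_isProbabilityMeasure P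
    exact (abs_nonneg _).trans (hgK (Classical.arbitrary Ω))
  have hbd : ∀ᵐ ω ∂P, ‖g ω * f (clippedReward r t a ω)‖ ≤ K * M := by
    refine .of_forall fun ω => ?_
    rw [Real.norm_eq_abs, abs_mul]
    exact mul_le_mul (hgK ω) (hfM _ (clip01_mem _)) (abs_nonneg _) hK
  have h1 := condExp_stronglyMeasurable_mul_of_bound hm'0 hφ hind _ hbd
  have h2 : ∀ᵐ ω ∂P, alg.prob (alg.stateAt (clippedReward r) A t ω) a
      = alg.prob (alg.stateAt r A t ω) a :=
    h.ae_stateAt_eq.mono fun ω hω => by rw [hω t ht.le]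
  -- Condition on the past together with the rewards of the round: only the choice of the arm is
  -- still random, and its indicator becomes the prescribed probability.
  have h3 : ∫ ω, (g ω * f (clippedReward r t a ω))
        * Set.indicator {ω | A t ω = a} (fun _ => (1 : ℝ)) ω ∂P
      = ∫ ω, (g ω * alg.prob (alg.stateAt (clippedReward r) A t ω) a)
        * f (clippedReward r t a ω) ∂P := by
    rw [← integral_condExp hm'0]
    refine integral_congr_ae ?_
    filter_upwards [h1, h2, h.law_arm t ht a] with ω e1 e2 e3
    refine e1.trans ?_
    rw [Pi.mul_apply, e3, e2]
    ring
  rw [h3]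
  -- What is left is a function of the past times a function of the fresh rewards.
  have hindep : IndepFun (fun ω => g ω * alg.prob (alg.stateAt (clippedReward r) A t ω) a)
      (fun ω => f (clippedReward r t a ω)) P := by
    rw [IndepFun_iff_Indep]
    exact indep_of_indep_of_le_left (indep_of_indep_of_le_right (h.indep_past t ht).symm
      hfr.comap_le) (Measurable.mul hg hp).comap_le
  rw [hindep.integral_fun_mul_eq_mul_integral
    ((Measurable.mul hg hp).mono (h.pastSigma_le t) le_rfl).aestronglyMeasurable
    (hfr.mono (h.rewardSigma_le t) le_rfl).aestronglyMeasurable]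
  congr 1
  rw [← h.law_reward t ht a, integral_map (h.measurable_reward t a).aemeasurable
    hf.aestronglyMeasurable]
  refine integral_congr_ae ?_
  filter_upwards [h.ae_clippedReward_eq] with ω hω
  rw [hω t ht a]

/-- Integrating out one round, for a function of the past, the arm and its reward. -/
lemma integral_round [IsProbabilityMeasure P] (h : IsRun P B alg T r A) {t : ℕ} (ht : t < T)
    (hp : ∀ a, Measurable[pastSigma r A t]
      fun ω => alg.prob (alg.stateAt (clippedReward r) A t ω) a)
    {g : Fin k → Ω → ℝ} (hg : ∀ a, Measurable[pastSigma r A t] (g a)) {K : ℝ}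
    (hgK : ∀ a ω, |g a ω| ≤ K)
    {f : Fin k → ℝ → ℝ} (hf : ∀ a, Measurable (f a)) {M : ℝ}
    (hfM : ∀ a, ∀ x ∈ Set.Icc (0 : ℝ) 1, |f a x| ≤ M) :
    ∫ ω, g (A t ω) ω * f (A t ω) (clippedReward r t (A t ω) ω) ∂P
      = ∑ a, (∫ ω, g a ω * alg.prob (alg.stateAt (clippedReward r) A t ω) a ∂P)
        * ∫ x, f a x ∂(B.dist a : Measure ℝ) := by
  have h1 : (fun ω => g (A t ω) ω * f (A t ω) (clippedReward r t (A t ω) ω))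
      = fun ω => ∑ a, (g a ω * f a (clippedReward r t a ω))
        * Set.indicator {ω | A t ω = a} (fun _ => (1 : ℝ)) ω := by
    funext ω
    simp [Set.indicator_apply]
  rw [h1, integral_finsetSum]
  · exact Finset.sum_congr rfl fun a _ => h.integral_round_arm ht a (hp a) (hg a) (hgK a) (hf a)
      (hfM a)
  · intro a _
    have hset : MeasurableSet {ω | A t ω = a} := h.measurable_arm t (measurableSet_singleton a)
    refine Integrable.of_bound (C := K * M) (Measurable.aestronglyMeasurable ?_)
      (.of_forall fun ω => ?_)
    · exact (((hg a).mono (h.pastSigma_le t) le_rfl).mul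
        ((hf a).comp (h.measurable_clippedReward t a))).mul (measurable_const.indicator hset)
    · have hK : 0 ≤ K := (abs_nonneg _).trans (hgK a ω)
      have h1 : |g a ω * f a (clippedReward r t a ω)| ≤ K * M := by
        rw [abs_mul]
        exact mul_le_mul (hgK a ω) (hfM a _ (clip01_mem _)) (abs_nonneg _) hK
      have h0 := (abs_nonneg _).trans h1
      rw [Real.norm_eq_abs, Set.indicator_apply]
      split_ifs
      · simpa using h1
      · simpa using h0

end IsRun

/-- After clipped rewards, the prescribed weights are probability distributions that depend
measurably on the past. -/
structure BanditAlgorithm.Regular {k : ℕ} {Ω : Type*} (alg : BanditAlgorithm k)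
    (r : ℕ → Fin k → Ω → ℝ) (A : ℕ → Ω → Fin k) : Prop where
  measurable_prob : ∀ t a, Measurable[pastSigma r A t]
    fun ω => alg.prob (alg.stateAt (clippedReward r) A t ω) a
  prob_nonneg : ∀ t a ω, 0 ≤ alg.prob (alg.stateAt (clippedReward r) A t ω) a
  sum_prob : ∀ t ω, ∑ a, alg.prob (alg.stateAt (clippedReward r) A t ω) a = 1

lemma BanditAlgorithm.Regular.prob_le_one {k : ℕ} {Ω : Type*} {alg : BanditAlgorithm k}
    {r : ℕ → Fin k → Ω → ℝ} {A : ℕ → Ω → Fin k} (hR : alg.Regular r A) (t : ℕ) (a : Fin k)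
    (ω : Ω) : alg.prob (alg.stateAt (clippedReward r) A t ω) a ≤ 1 := by
  rw [← hR.sum_prob t ω]
  exact Finset.single_le_sum (f := fun a => alg.prob (alg.stateAt (clippedReward r) A t ω) a)
    (fun b _ => hR.prob_nonneg t b ω) (Finset.mem_univ a)

/-! ### From the pseudo-regret to expected gaps. -/

namespace IsRun

variable {k : ℕ} {Ω : Type*} [mΩ : MeasurableSpace Ω] {P : Measure Ω} [IsProbabilityMeasure P]
  {B : StochasticBandit k} {alg : BanditAlgorithm k} {T : ℕ}
  {r : ℕ → Fin k → Ω → ℝ} {A : ℕ → Ω → Fin k}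

lemma integrable_prob (h : IsRun P B alg T r A) (hR : alg.Regular r A) (t : ℕ) (a : Fin k) :
    Integrable (fun ω => alg.prob (alg.stateAt (clippedReward r) A t ω) a) P :=
  Integrable.of_bound ((hR.measurable_prob t a).mono (h.pastSigma_le t) le_rfl).aestronglyMeasurable
    1 (.of_forall fun ω => by
      rw [Real.norm_eq_abs, abs_of_nonneg (hR.prob_nonneg t a ω)]
      exact hR.prob_le_one t a ω)

lemma integrable_clippedReward (h : IsRun P B alg T r A) (t : ℕ) (a : Fin k) :
    Integrable (clippedReward r t a) P :=
  Integrable.of_bound (h.measurable_clippedReward t a).aestronglyMeasurable 1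
    (.of_forall fun ω => by
      rw [Real.norm_eq_abs, abs_of_nonneg (clippedReward_nonneg ..)]
      exact clippedReward_le_one ..)

lemma integrable_playedReward (h : IsRun P B alg T r A) (t : ℕ) :
    Integrable (fun ω => clippedReward r t (A t ω) ω) P :=
  Integrable.of_bound (h.measurable_playedReward t).aestronglyMeasurable 1
    (.of_forall fun ω => by
      rw [Real.norm_eq_abs, abs_of_nonneg (clippedReward_nonneg ..)]
      exact clippedReward_le_one ..)

lemma integral_playedReward (h : IsRun P B alg T r A) (hR : alg.Regular r A) {t : ℕ}
    (ht : t < T) :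
    ∫ ω, clippedReward r t (A t ω) ω ∂P
      = ∑ a, (∫ ω, alg.prob (alg.stateAt (clippedReward r) A t ω) a ∂P) * B.mean a := by
  have := h.integral_round ht (hR.measurable_prob t) (g := fun _ _ => 1)
    (fun _ => measurable_const) (K := 1) (by simp) (f := fun _ x => x) (fun _ => measurable_id)
    (M := 1) (fun _ x hx => abs_le.2 ⟨by linarith [hx.1], hx.2⟩)
  simpa [StochasticBandit.mean] using this

lemma sum_integral_prob (h : IsRun P B alg T r A) (hR : alg.Regular r A) (t : ℕ) :
    ∑ a, ∫ ω, alg.prob (alg.stateAt (clippedReward r) A t ω) a ∂P = 1 := by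
  rw [← integral_finsetSum _ fun a _ => h.integrable_prob hR t a]
  simp [hR.sum_prob]

/-- The pseudo-regret is at most the expected total gap. -/
lemma pseudoRegret_le (hk : 0 < k) (h : IsRun P B alg T r A) (hR : alg.Regular r A) :
    pseudoRegret P T r A ≤ ∑ t ∈ Finset.range T, ∑ a,
      (∫ ω, alg.prob (alg.stateAt (clippedReward r) A t ω) a ∂P) * B.gap a := by
  have : Nonempty (Fin k) := ⟨⟨0, hk⟩⟩
  refine ciSup_le fun a => ?_
  have h1 : ∫ ω, ∑ t ∈ Finset.range T, (r t a ω - r t (A t ω) ω) ∂P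
      = ∫ ω, ∑ t ∈ Finset.range T,
        (clippedReward r t a ω - clippedReward r t (A t ω) ω) ∂P := by
    refine integral_congr_ae ?_
    filter_upwards [h.ae_clippedReward_eq] with ω hω
    refine Finset.sum_congr rfl fun t ht => ?_
    rw [hω t (Finset.mem_range.1 ht), hω t (Finset.mem_range.1 ht)]
  have h2 : ∀ t ∈ Finset.range T,
      Integrable (fun ω => clippedReward r t a ω - clippedReward r t (A t ω) ω) P :=
    fun t _ => (h.integrable_clippedReward t a).sub (h.integrable_playedReward t)
  rw [h1, integral_finsetSum _ h2]
  refine Finset.sum_le_sum fun t ht => ?_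
  have ht := Finset.mem_range.1 ht
  rw [integral_sub (h.integrable_clippedReward t a) (h.integrable_playedReward t),
    h.integral_clippedReward ht, h.integral_playedReward hR ht]
  simp only [StochasticBandit.gap, mul_sub, Finset.sum_sub_distrib]
  rw [← Finset.sum_mul, h.sum_integral_prob hR t, one_mul]
  linarith [B.mean_le_bestMean a]

end IsRun

/-! ### One step of log-barrier mirror descent -/

section LogBarrier

variable {k : ℕ} {p : Fin k → ℝ} {η x : ℝ} {a : Fin k}

lemma logBarrier_denom_pos (hp : ∀ b, 0 < p b) (h1 : η * x < 1) {γ : ℝ}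
    (hγ : 0 ≤ γ) (b : Fin k) : 0 < 1 - (if b = a then η * x else 0) + γ * p b := by
  have := mul_nonneg hγ (hp b).le
  split_ifs <;> linarith

lemma logBarrierUpdate_pos (hp : ∀ b, 0 < p b) (h1 : η * x < 1) {γ : ℝ}
    (hγ : 0 ≤ γ) (b : Fin k) : 0 < logBarrierUpdate p η a x γ b :=
  div_pos (hp b) (logBarrier_denom_pos hp h1 hγ b)

lemma normalizer_spec (hp : ∀ b, 0 < p b) (hsum : ∑ b, p b = 1) (h0 : 0 ≤ η * x)
    (h1 : η * x < 1) : 0 ≤ normalizer p η a x ∧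
      ∑ b, logBarrierUpdate p η a x (normalizer p η a x) b = 1 := by
  obtain ⟨γ, hγ, huniq⟩ := existsUnique_normalizer p hp hsum η a x h0 h1
  have hset : {γ : ℝ | 0 ≤ γ ∧ ∑ b, logBarrierUpdate p η a x γ b = 1} = {γ} :=
    Set.eq_singleton_iff_unique_mem.2 ⟨hγ, huniq⟩
  have : normalizer p η a x = γ := by rw [normalizer, hset, csInf_singleton]
  rw [this]
  exact hγ

lemma sum_logBarrierUpdate_antitone (hp : ∀ b, 0 < p b)
    (h1 : η * x < 1) {γ₁ γ₂ : ℝ} (hγ : 0 ≤ γ₁) (hlt : γ₁ < γ₂) :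
    ∑ b, logBarrierUpdate p η a x γ₂ b < ∑ b, logBarrierUpdate p η a x γ₁ b := by
  refine Finset.sum_lt_sum_of_nonempty ⟨a, Finset.mem_univ a⟩ fun b _ => ?_
  refine div_lt_div_of_pos_left (hp b) (logBarrier_denom_pos hp h1 hγ b) ?_
  have := mul_lt_mul_of_pos_right hlt (hp b)
  linarith

/-- The sum of the updated weights is strictly decreasing in `γ`. The right-hand side no longer
mentions the infimum, which is what makes `normalizer` measurable in its arguments. -/
lemma normalizer_lt_iff (hp : ∀ b, 0 < p b) (hsum : ∑ b, p b = 1) (h0 : 0 ≤ η * x)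
    (h1 : η * x < 1) {c : ℝ} (hc : 0 ≤ c) :
    normalizer p η a x < c ↔ ∑ b, logBarrierUpdate p η a x c b < 1 := by
  obtain ⟨hn, hs⟩ := normalizer_spec (a := a) hp hsum h0 h1
  constructor
  · intro h
    rw [← hs]
    exact sum_logBarrierUpdate_antitone hp h1 hn h
  · intro h
    by_contra hcon
    rcases (not_lt.1 hcon).eq_or_lt with h' | h'
    · rw [h'] at h
      linarith
    · have := sum_logBarrierUpdate_antitone (a := a) hp h1 hc h'
      linarith

/-- At `γ = k` each denominator exceeds `k * p b`, so each weight is at most `1 / k` and the sum is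
already at most one. -/
lemma normalizer_le (hp : ∀ b, 0 < p b) (hsum : ∑ b, p b = 1) (h0 : 0 ≤ η * x)
    (h1 : η * x < 1) : normalizer p η a x ≤ k := by
  have hk : (0 : ℝ) < k := by exact_mod_cast a.pos
  by_contra hcon
  rw [not_le] at hcon
  obtain ⟨hn, hs⟩ := normalizer_spec (a := a) hp hsum h0 h1
  have h2 := sum_logBarrierUpdate_antitone (a := a) hp h1 hk.le hcon
  have h3 : ∑ b, logBarrierUpdate p η a x k b ≤ ∑ _b : Fin k, 1 / (k : ℝ) := by
    refine Finset.sum_le_sum fun b _ => ?_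
    unfold logBarrierUpdate
    rw [div_le_div_iff₀ (logBarrier_denom_pos hp h1 hk.le b) hk]
    split_ifs <;> nlinarith [hp b]
  have h4 : ∑ _b : Fin k, 1 / (k : ℝ) = 1 := by simp [hk.ne']
  linarith

lemma inv_logBarrierUpdate (hp : ∀ b, 0 < p b) {γ : ℝ} (b : Fin k) :
    1 / logBarrierUpdate p η a x γ b
      = 1 / p b - (if b = a then η * x / p b else 0) + γ := by
  have := (hp b).ne'
  rw [logBarrierUpdate, one_div_div]
  split_ifs <;> field_simp
  ring

/-- Inverse probabilities grow at most linearly in time. This crude bound keeps the importance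
weights bounded, hence integrable. -/
lemma inv_logBarrierUpdate_le (hp : ∀ b, 0 < p b) (hsum : ∑ b, p b = 1) (h0 : 0 ≤ η * x)
    (h1 : η * x < 1) (b : Fin k) :
    1 / logBarrierUpdate p η a x (normalizer p η a x) b ≤ 1 / p b + k := by
  rw [inv_logBarrierUpdate hp]
  have h2 := normalizer_le (a := a) hp hsum h0 h1
  have h3 : 0 ≤ η * x / p b := div_nonneg h0 (hp b).le
  split_ifs <;> linarith

/-- The Bregman divergence of the log-barrier `-∑ log`. -/
def logBarrierDiv (u p : Fin k → ℝ) : ℝ := ∑ b, (u b / p b - 1 - Real.log (u b / p b))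

lemma logBarrierDiv_nonneg {u : Fin k → ℝ} (hu : ∀ b, 0 < u b) (hp : ∀ b, 0 < p b) :
    0 ≤ logBarrierDiv u p :=
  Finset.sum_nonneg fun b _ => by
    have := Real.log_le_sub_one_of_pos (div_pos (hu b) (hp b))
    linarith

/-- The squared local norm of the centered reward estimate. -/
def estimateVar (p : Fin k → ℝ) (a : Fin k) (x : ℝ) : ℝ :=
  ∑ b, p b ^ 2 * (rewardEstimate p a x b - x) ^ 2

lemma estimateVar_eq (hp : ∀ b, 0 < p b) :
    estimateVar p a x = ∑ b, (x * (p b - if b = a then 1 else 0)) ^ 2 := by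
  refine Finset.sum_congr rfl fun b _ => ?_
  have := (hp b).ne'
  rw [rewardEstimate]
  split_ifs
  · field_simp
    ring
  · ring

lemma estimateVar_nonneg : 0 ≤ estimateVar p a x :=
  Finset.sum_nonneg fun b _ => by positivity

lemma le_one_of_sum_eq_one (hp : ∀ b, 0 < p b) (hsum : ∑ b, p b = 1) (b : Fin k) : p b ≤ 1 := by
  rw [← hsum]
  exact Finset.single_le_sum (fun c _ => (hp c).le) (Finset.mem_univ b)

/-- Source of both savings: `x² ≤ x` makes the bound linear in the reward, which later yields the
factor `bestMean`; centering the estimate at `x` yields the factor `1 - p a`, which is small once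
the pulled arm dominates. -/
lemma estimateVar_le (hp : ∀ b, 0 < p b) (hsum : ∑ b, p b = 1) (hx0 : 0 ≤ x) (hx1 : x ≤ 1) :
    estimateVar p a x ≤ 2 * (1 - p a) * x := by
  rw [estimateVar_eq hp]
  have h : ∀ b, (x * (p b - if b = a then 1 else 0)) ^ 2
      ≤ x * (p b + if b = a then 1 - 2 * p a else 0) := by
    intro b
    have h1 := le_one_of_sum_eq_one hp hsum b
    have h2 : x ^ 2 ≤ x := by nlinarith
    have h3 := hp b
    split_ifs with hb
    · subst hb
      nlinarith [mul_nonneg hx0 (mul_nonneg h3.le (sub_nonneg.2 h1)),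
        mul_le_mul_of_nonneg_right h2 (sq_nonneg (p b - 1))]
    · nlinarith [mul_nonneg hx0 (mul_nonneg h3.le (sub_nonneg.2 h1)),
        mul_le_mul_of_nonneg_right h2 (sq_nonneg (p b))]
  refine (Finset.sum_le_sum fun b _ => h b).trans (le_of_eq ?_)
  rw [← Finset.mul_sum, Finset.sum_add_distrib, hsum]
  simp
  ring

lemma sub_log_one_add_le {w η₀ : ℝ} (hη : η₀ < 1) (hw : -η₀ ≤ w) :
    w - Real.log (1 + w) ≤ w ^ 2 / (1 - η₀) := by
  have h1 : 0 < 1 + w := by linarith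
  have h2 := Real.one_sub_inv_le_log_of_pos h1
  have h3 : w - (1 - (1 + w)⁻¹) = w ^ 2 / (1 + w) := by field_simp; ring
  have h4 : w ^ 2 / (1 + w) ≤ w ^ 2 / (1 - η₀) :=
    div_le_div_of_nonneg_left (sq_nonneg w) (by linarith) (by linarith)
  linarith

/-- The basic inequality for one step of log-barrier mirror descent. -/
lemma logBarrierDiv_step {η₀ : ℝ} {u : Fin k → ℝ} (hu : ∀ b, 0 < u b) (husum : ∑ b, u b = 1)
    (hp : ∀ b, 0 < p b) (hsum : ∑ b, p b = 1) (hη : 0 < η) (hη₀ : η ≤ η₀) (h1 : η₀ < 1)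
    (hx0 : 0 ≤ x) (hx1 : x ≤ 1) :
    η * (u a * x / p a - x)
        + logBarrierDiv u (logBarrierUpdate p η a x (normalizer p η a x))
      ≤ logBarrierDiv u p + η ^ 2 * estimateVar p a x / (1 - η₀) := by
  have hηx0 : 0 ≤ η * x := mul_nonneg hη.le hx0
  have hηx : η * x ≤ η₀ := by nlinarith
  have hηx1 : η * x < 1 := by linarith
  obtain ⟨hn, hs⟩ := normalizer_spec (a := a) hp hsum hηx0 hηx1
  set γ := normalizer p η a x
  set D : ℝ → Fin k → ℝ := fun γ b => 1 - (if b = a then η * x else 0) + γ * p b with hD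
  have hDpos : ∀ γ, 0 ≤ γ → ∀ b, 0 < D γ b := fun γ hγ b =>
    logBarrier_denom_pos hp hηx1 hγ b
  -- An exact identity: the update multiplies `u b / p b` by `D γ b`.
  have hdiff : logBarrierDiv u p - logBarrierDiv u (logBarrierUpdate p η a x γ)
      = η * (u a * x / p a) - γ + ∑ b, Real.log (D γ b) := by
    have hb : ∀ b, (u b / p b - 1 - Real.log (u b / p b))
        - (u b / logBarrierUpdate p η a x γ b - 1
          - Real.log (u b / logBarrierUpdate p η a x γ b))
        = ((if b = a then η * (u a * x / p a) else 0) - u b * γ) + Real.log (D γ b) := by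
      intro b
      have e1 : u b / logBarrierUpdate p η a x γ b = u b / p b * D γ b := by
        have := (hp b).ne'
        have := (hDpos γ hn b).ne'
        rw [logBarrierUpdate]
        field_simp
        simp only [hD]
        ring
      rw [e1, Real.log_mul (div_pos (hu b) (hp b)).ne' (hDpos γ hn b).ne']
      have e2 : u b / p b * D γ b
          = u b / p b - (if b = a then η * (u a * x / p a) else 0) + u b * γ := by
        have := (hp b).ne'
        simp only [hD]
        split_ifs with hba
        · subst hba
          field_simp
        · field_simp
          ring
      rw [e2]
      ring
    rw [logBarrierDiv, logBarrierDiv, ← Finset.sum_sub_distrib, Finset.sum_congr rfl fun b _ => hb b,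
      Finset.sum_add_distrib, Finset.sum_sub_distrib, ← Finset.sum_mul, husum]
    simp
  -- The convex function `γ ↦ γ - ∑ log (D γ b)` has derivative one minus the sum of the updated
  -- weights, so the normalizer minimizes it. The competitor `η * x` amounts to centering the reward
  -- estimate at `x`.
  have hmin : γ - ∑ b, Real.log (D γ b) ≤ η * x - ∑ b, Real.log (D (η * x) b) := by
    have e1 : ∀ b, Real.log (D (η * x) b) - Real.log (D γ b)
        ≤ (η * x - γ) * logBarrierUpdate p η a x γ b := by
      intro b
      have hd1 := hDpos γ hn b
      have hd2 := hDpos (η * x) hηx0 b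
      rw [← Real.log_div hd2.ne' hd1.ne']
      refine (Real.log_le_sub_one_of_pos (div_pos hd2 hd1)).trans (le_of_eq ?_)
      have e3 : logBarrierUpdate p η a x γ b = p b / D γ b := rfl
      rw [e3]
      field_simp
      simp only [hD]
      ring
    have e2 := Finset.sum_le_sum fun b (_ : b ∈ Finset.univ) => e1 b
    rw [← Finset.mul_sum, hs, Finset.sum_sub_distrib] at e2
    linarith
  -- Here `D (η * x) b = 1 + w b` with `∑ w b = 0`, so only the quadratic terms survive.
  have hlog : - ∑ b, Real.log (D (η * x) b) ≤ η ^ 2 * estimateVar p a x / (1 - η₀) := by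
    have e1 : ∀ b, η * x * (p b - if b = a then 1 else 0) - Real.log (D (η * x) b)
        ≤ η ^ 2 * (x * (p b - if b = a then 1 else 0)) ^ 2 / (1 - η₀) := by
      intro b
      have e3 := sub_log_one_add_le (w := η * x * (p b - if b = a then 1 else 0)) h1 (by
        have := (hp b).le
        split_ifs <;> nlinarith)
      have e4 : 1 + η * x * (p b - if b = a then 1 else 0) = D (η * x) b := by
        simp only [hD]
        split_ifs <;> ring
      rw [e4] at e3
      refine e3.trans (le_of_eq ?_)
      ring
    have e2 := Finset.sum_le_sum fun b (_ : b ∈ Finset.univ) => e1 b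
    rw [Finset.sum_sub_distrib, ← Finset.mul_sum, Finset.sum_sub_distrib, hsum,
      ← Finset.sum_div, ← Finset.mul_sum, ← estimateVar_eq hp] at e2
    simpa using e2
  linarith

end LogBarrier

/-! ### Pathwise analysis of BROAD -/

/-- State of BROAD at the beginning of round `t`, run on the clipped rewards. -/
def broadState {k : ℕ} {Ω : Type*} (T : ℕ) (η₀ : ℝ) (r : ℕ → Fin k → Ω → ℝ) (A : ℕ → Ω → Fin k)
    (t : ℕ) (ω : Ω) : BROADState k :=
  (BROAD k T η₀).stateAt (clippedReward r) A t ω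

section Broad

variable {k : ℕ} {Ω : Type*} {T : ℕ} {η₀ : ℝ} {r : ℕ → Fin k → Ω → ℝ} {A : ℕ → Ω → Fin k}

/-- The observed (clipped) reward. -/
def playedReward (r : ℕ → Fin k → Ω → ℝ) (A : ℕ → Ω → Fin k) (t : ℕ) (ω : Ω) : ℝ :=
  clippedReward r t (A t ω) ω

/-- The criterion for restarting BROAD. -/
def broadRestarts (T : ℕ) (s : BROADState k) (a : Fin k) (x : ℝ) : Prop :=
  k * Real.log T / (3 * s.η ^ 2) ≤ s.V + estimateVar s.p a x

lemma broadState_zero (ω : Ω) :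
    broadState T η₀ r A 0 ω = { p := fun _ => 1 / (k : ℝ), η := η₀, V := 0 } := rfl

lemma broadState_succ_of_restarts {t : ℕ} {ω : Ω}
    (h : broadRestarts T (broadState T η₀ r A t ω) (A t ω) (playedReward r A t ω)) :
    broadState T η₀ r A (t + 1) ω
      = { p := fun _ => 1 / (k : ℝ), η := (broadState T η₀ r A t ω).η / 2, V := 0 } :=
  if_pos h

lemma broadState_succ_of_not_restarts {t : ℕ} {ω : Ω}
    (h : ¬ broadRestarts T (broadState T η₀ r A t ω) (A t ω) (playedReward r A t ω)) :
    broadState T η₀ r A (t + 1) ω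
      = { p := logBarrierUpdate (broadState T η₀ r A t ω).p (broadState T η₀ r A t ω).η (A t ω)
            (playedReward r A t ω) (normalizer (broadState T η₀ r A t ω).p
            (broadState T η₀ r A t ω).η (A t ω) (playedReward r A t ω))
          η := (broadState T η₀ r A t ω).η
          V := (broadState T η₀ r A t ω).V
            + estimateVar (broadState T η₀ r A t ω).p (A t ω) (playedReward r A t ω) } :=
  if_neg h

/-- The invariants of the state of BROAD before round `t`. -/
structure BROADState.Valid (s : BROADState k) (η₀ : ℝ) (t : ℕ) : Prop where
  p_pos : ∀ b, 0 < s.p b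
  p_sum : ∑ b, s.p b = 1
  η_pos : 0 < s.η
  η_le : s.η ≤ η₀
  inv_p_le : ∀ b, 1 / s.p b ≤ k * (t + 1)

lemma playedReward_nonneg (t : ℕ) (ω : Ω) : 0 ≤ playedReward r A t ω := clippedReward_nonneg ..

lemma playedReward_le_one (t : ℕ) (ω : Ω) : playedReward r A t ω ≤ 1 := clippedReward_le_one ..

lemma BROADState.Valid.step_bounds {s : BROADState k} {t : ℕ} (hs : s.Valid η₀ t)
    (h1 : η₀ < 1) {x : ℝ} (hx0 : 0 ≤ x) (hx1 : x ≤ 1) : 0 ≤ s.η * x ∧ s.η * x < 1 := by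
  have := hs.η_pos
  have := hs.η_le
  constructor
  · positivity
  · nlinarith

lemma valid_uniform (hk : 0 < k) {η V : ℝ} (h0 : 0 < η) (h1 : η ≤ η₀) (t : ℕ) :
    (BROADState.mk (fun _ : Fin k => 1 / (k : ℝ)) η V).Valid η₀ t := by
  have hk' : (0 : ℝ) < k := by exact_mod_cast hk
  refine ⟨fun _ => by positivity, by simp [hk'.ne'], h0, h1, fun b => ?_⟩
  rw [one_div_one_div]
  nlinarith [(Nat.cast_nonneg t : (0 : ℝ) ≤ t)]

lemma broadState_valid (hk : 0 < k) (h0 : 0 < η₀) (h1 : η₀ < 1) (ω : Ω) :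
    ∀ t, (broadState T η₀ r A t ω).Valid η₀ t
  | 0 => valid_uniform hk h0 le_rfl 0
  | t + 1 => by
    have ih := broadState_valid hk h0 h1 ω t
    by_cases h : broadRestarts T (broadState T η₀ r A t ω) (A t ω) (playedReward r A t ω)
    · rw [broadState_succ_of_restarts h]
      exact valid_uniform hk (half_pos ih.η_pos) (by linarith [ih.η_pos, ih.η_le]) _
    · obtain ⟨b0, b1⟩ := ih.step_bounds h1 (playedReward_nonneg (r := r) (A := A) t ω)
        (playedReward_le_one t ω)
      obtain ⟨hn, hs⟩ := normalizer_spec (a := A t ω) ih.p_pos ih.p_sum b0 b1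
      rw [broadState_succ_of_not_restarts h]
      refine ⟨logBarrierUpdate_pos ih.p_pos b1 hn, hs, ih.η_pos, ih.η_le, fun b => ?_⟩
      have := inv_logBarrierUpdate_le (a := A t ω) ih.p_pos ih.p_sum b0 b1 b
      have := ih.inv_p_le b
      push_cast
      linarith

/-- Sum of the squared local norms over the first `t` rounds. -/
def totalVar (T : ℕ) (η₀ : ℝ) (r : ℕ → Fin k → Ω → ℝ) (A : ℕ → Ω → Fin k) (t : ℕ) (ω : Ω) : ℝ :=
  ∑ s ∈ Finset.range t, estimateVar (broadState T η₀ r A s ω).p (A s ω) (playedReward r A s ω)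

/-- Sum over the first `t` rounds of `⟨u - p, r̂⟩`, the estimated regret against `u`. -/
def estimatedRegret (u : Fin k → ℝ) (T : ℕ) (η₀ : ℝ) (r : ℕ → Fin k → Ω → ℝ)
    (A : ℕ → Ω → Fin k) (t : ℕ) (ω : Ω) : ℝ :=
  ∑ s ∈ Finset.range t, (u (A s ω) * playedReward r A s ω / (broadState T η₀ r A s ω).p (A s ω)
    - playedReward r A s ω)

lemma half_le_log {T : ℕ} (hT : 2 ≤ T) : 1 / 2 ≤ Real.log T := by
  have h2 : Real.log 2 ≤ Real.log T := Real.log_le_log (by norm_num) (by exact_mod_cast hT)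
  linarith [Real.log_two_gt_d9]

/-- The invariant survives a restart: `G`, `V`, `W` are estimated regret, current and total
variance, `g` and `v` the increments of the round, and `Bp`, `Bq`, `Bu` the divergences before the
step, after it and from the uniform distribution. The restart criterion turns into the lower bound
for the total variance in terms of the halved rate. -/
lemma restart_arith {η Q c G g W V v Bu Bp Bq : ℝ} (hη : 0 < η) (hη1 : η ≤ 1) (hQ : 1 / 2 ≤ Q)
    (hc : 0 < c) (hBu : Bu ≤ Q) (hBq : 0 ≤ Bq) (hV : V ≤ Q / (3 * η ^ 2)) (hv : v ≤ 2)
    (hstep : η * g + Bq ≤ Bp + η ^ 2 * v * c)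
    (hG : G + Bp / η ≤ η * V * c + (2 + 5 * c) * Q / η)
    (hVW : V ≤ W) (h : Q / (3 * η ^ 2) ≤ V + v) :
    G + g + Bu / (η / 2) ≤ η / 2 * 0 * c + (2 + 5 * c) * Q / (η / 2) ∧
      Q / (12 * (η / 2) ^ 2) ≤ W + v ∧ 0 ≤ Q / (3 * (η / 2) ^ 2) := by
  have hQ0 : 0 < Q := by linarith
  have hpos : 0 < Q / (3 * η ^ 2) := by positivity
  refine ⟨?_, ?_, by positivity⟩
  · have h1 : g ≤ Bp / η + η * v * c := by
      have e1 : η * g ≤ η * (Bp / η + η * v * c) := by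
        have : η * (Bp / η + η * v * c) = Bp + η ^ 2 * v * c := by field_simp
        linarith
      exact le_of_mul_le_mul_left e1 hη
    have h2 : η * V * c ≤ c * Q / 3 / η := by
      have e1 := mul_le_mul_of_nonneg_left hV (mul_pos hη hc).le
      have e2 : η * c * (Q / (3 * η ^ 2)) = c * Q / 3 / η := by field_simp
      linarith
    have h3 : η * v * c ≤ 4 * (c * Q) / η := by
      rw [le_div_iff₀ hη]
      have e1 : η * v * c * η ≤ 2 * c := by
        have : η ^ 2 * v ≤ 2 := by
          have : η ^ 2 ≤ 1 := by nlinarith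
          nlinarith [sq_nonneg η]
        nlinarith
      nlinarith
    have h4 : Bu / (η / 2) ≤ 2 * Q / η := by
      rw [show Bu / (η / 2) = 2 * Bu / η by field_simp]
      exact div_le_div_of_nonneg_right (by linarith) hη.le
    -- Halving `η` doubles the allowance `(2 + 5c) Q / η`, and the gain pays for the finished phase
    -- and the new initial divergence: `c/3 + 4c + 2 ≤ 2 + 5c`.
    have h5 : c * Q / 3 / η + 4 * (c * Q) / η + (2 + 5 * c) * Q / η + 2 * Q / η
        ≤ (2 + 5 * c) * Q / (η / 2) := by
      rw [show (2 + 5 * c) * Q / (η / 2) = 2 * ((2 + 5 * c) * Q) / η by field_simp,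
        ← add_div, ← add_div, ← add_div]
      refine div_le_div_of_nonneg_right ?_ hη.le
      nlinarith [mul_pos hc hQ0]
    linarith
  · have : Q / (12 * (η / 2) ^ 2) = Q / (3 * η ^ 2) := by
      field_simp
      norm_num
    linarith

/-- The potential argument for BROAD: the estimated regret, the sum since the last restart and
the learning rate. -/
lemma broad_invariant (hk : 0 < k) (h0 : 0 < η₀) (h1 : η₀ < 1) (hT : 2 ≤ T) {u : Fin k → ℝ}
    (hu : ∀ b, 0 < u b) (husum : ∑ b, u b = 1)
    (hdiv : logBarrierDiv u (fun _ => 1 / (k : ℝ)) ≤ k * Real.log T) (ω : Ω) (t : ℕ) :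
    estimatedRegret u T η₀ r A t ω
        + logBarrierDiv u (broadState T η₀ r A t ω).p / (broadState T η₀ r A t ω).η
      ≤ (broadState T η₀ r A t ω).η * (broadState T η₀ r A t ω).V / (1 - η₀)
        + (2 + 5 / (1 - η₀)) * (k * Real.log T) / (broadState T η₀ r A t ω).η
    ∧ (broadState T η₀ r A t ω).V ≤ totalVar T η₀ r A t ω
    ∧ ((broadState T η₀ r A t ω).η = η₀
      ∨ k * Real.log T / (12 * (broadState T η₀ r A t ω).η ^ 2) ≤ totalVar T η₀ r A t ω)
    ∧ (broadState T η₀ r A t ω).V ≤ k * Real.log T / (3 * (broadState T η₀ r A t ω).η ^ 2) := by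
  have hk1 : (1 : ℝ) ≤ k := by exact_mod_cast hk
  have hlog := half_le_log hT
  set Q := k * Real.log T with hQ
  have hQ2 : 1 / 2 ≤ Q := by nlinarith
  have hc : 0 < 1 - η₀ := by linarith
  set c := 1 / (1 - η₀) with hcdef
  have hc0 : 0 < c := by positivity
  have e5 : 5 / (1 - η₀) = 5 * c := by rw [hcdef]; ring
  have ediv : ∀ y : ℝ, y / (1 - η₀) = y * c := fun y => by rw [hcdef]; ring
  rw [e5]
  induction t with
  | zero =>
    rw [broadState_zero]
    refine ⟨?_, by simp [totalVar], Or.inl rfl, by simp only; positivity⟩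
    simp only [estimatedRegret, Finset.range_zero, Finset.sum_empty, zero_add, mul_zero, zero_div]
    exact div_le_div_of_nonneg_right (by nlinarith) h0.le
  | succ t ih =>
    obtain ⟨ih1, ih2, ih3, ih4⟩ := ih
    have hv := broadState_valid (T := T) (r := r) (A := A) hk h0 h1 ω t
    have hx0 := playedReward_nonneg (r := r) (A := A) t ω
    have hx1 := playedReward_le_one (r := r) (A := A) t ω
    have hstep := logBarrierDiv_step (a := A t ω) hu husum hv.p_pos hv.p_sum hv.η_pos hv.η_le h1
      hx0 hx1
    obtain ⟨b0, b1⟩ := hv.step_bounds h1 hx0 hx1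
    obtain ⟨hn, hs⟩ := normalizer_spec (a := A t ω) hv.p_pos hv.p_sum b0 b1
    have hq := logBarrierDiv_nonneg hu (logBarrierUpdate_pos (a := A t ω) hv.p_pos b1 hn)
    have hvar0 : 0 ≤ estimateVar (broadState T η₀ r A t ω).p (A t ω) (playedReward r A t ω) :=
      estimateVar_nonneg
    have hvar2 : estimateVar (broadState T η₀ r A t ω).p (A t ω) (playedReward r A t ω) ≤ 2 := by
      have e1 := estimateVar_le (a := A t ω) hv.p_pos hv.p_sum hx0 hx1
      have e2 := hv.p_pos (A t ω)
      have e3 := le_one_of_sum_eq_one hv.p_pos hv.p_sum (A t ω)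
      nlinarith
    have hη := hv.η_pos
    have hηle := hv.η_le
    have htot : totalVar T η₀ r A (t + 1) ω = totalVar T η₀ r A t ω
        + estimateVar (broadState T η₀ r A t ω).p (A t ω) (playedReward r A t ω) :=
      Finset.sum_range_succ _ _
    have hG : estimatedRegret u T η₀ r A (t + 1) ω = estimatedRegret u T η₀ r A t ω
        + (u (A t ω) * playedReward r A t ω / (broadState T η₀ r A t ω).p (A t ω)
          - playedReward r A t ω) := Finset.sum_range_succ _ _
    by_cases h : broadRestarts T (broadState T η₀ r A t ω) (A t ω) (playedReward r A t ω)
    · rw [broadState_succ_of_restarts h, htot, hG]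
      unfold broadRestarts at h
      simp only [ediv] at *
      generalize broadState T η₀ r A t ω = s at *
      generalize estimatedRegret u T η₀ r A t ω = G at *
      generalize totalVar T η₀ r A t ω = W at *
      generalize estimateVar s.p (A t ω) (playedReward r A t ω) = v at *
      generalize u (A t ω) * playedReward r A t ω / s.p (A t ω) - playedReward r A t ω = g at *
      obtain ⟨r1, r2, r3⟩ := restart_arith hη (hηle.trans h1.le) hQ2 hc0 hdiv hq ih4 hvar2
        hstep ih1 ih2 h
      have hQ0 : 0 < Q := by linarith
      exact ⟨r1, le_trans (by positivity) r2, Or.inr r2, r3⟩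
    · rw [broadState_succ_of_not_restarts h, htot, hG]
      unfold broadRestarts at h
      simp only [ediv] at *
      generalize broadState T η₀ r A t ω = s at *
      generalize estimatedRegret u T η₀ r A t ω = G at *
      generalize totalVar T η₀ r A t ω = W at *
      generalize logBarrierDiv u (logBarrierUpdate s.p s.η (A t ω) (playedReward r A t ω)
        (normalizer s.p s.η (A t ω) (playedReward r A t ω))) = Bq at *
      generalize estimateVar s.p (A t ω) (playedReward r A t ω) = v at *
      generalize u (A t ω) * playedReward r A t ω / s.p (A t ω) - playedReward r A t ω = g at *
      refine ⟨?_, by linarith, ih3.imp_right fun h => by linarith, (not_le.1 h).le⟩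
      have e1 : Bq / s.η ≤ logBarrierDiv u s.p / s.η + s.η * v * c - g := by
        rw [div_le_iff₀ hη]
        have : (logBarrierDiv u s.p / s.η + s.η * v * c - g) * s.η
            = logBarrierDiv u s.p + s.η ^ 2 * v * c - s.η * g := by field_simp
        linarith
      rw [mul_add, add_mul]
      linarith

/-- Pathwise bound on the estimated regret of BROAD. -/
lemma estimatedRegret_le (hk : 0 < k) (h0 : 0 < η₀) (h1 : η₀ < 1) (hT : 2 ≤ T) {u : Fin k → ℝ}
    (hu : ∀ b, 0 < u b) (husum : ∑ b, u b = 1)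
    (hdiv : logBarrierDiv u (fun _ => 1 / (k : ℝ)) ≤ k * Real.log T) {μ : ℝ} (hμ : 0 < μ)
    (t : ℕ) (ω : Ω) :
    estimatedRegret u T η₀ r A t ω ≤ (2 + 6 / (1 - η₀)) * (k * Real.log T / η₀
      + μ * totalVar T η₀ r A t ω + 3 * (k * Real.log T) / μ) := by
  obtain ⟨i1, -, i3, i4⟩ := broad_invariant (r := r) (A := A) hk h0 h1 hT hu husum hdiv ω t
  have hv := broadState_valid (T := T) (r := r) (A := A) hk h0 h1 ω t
  have hW : 0 ≤ totalVar T η₀ r A t ω := Finset.sum_nonneg fun s _ => estimateVar_nonneg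
  have hB : 0 ≤ logBarrierDiv u (broadState T η₀ r A t ω).p / (broadState T η₀ r A t ω).η :=
    div_nonneg (logBarrierDiv_nonneg hu hv.p_pos) hv.η_pos.le
  have hη := hv.η_pos
  have hlog : 0 ≤ Real.log T := Real.log_natCast_nonneg T
  have hQ : 0 ≤ k * Real.log T := by positivity
  have hc : 0 < 1 - η₀ := by linarith
  have hc0 : 0 < 1 / (1 - η₀) := by positivity
  have e5 : 5 / (1 - η₀) = 5 * (1 / (1 - η₀)) := by ring
  have e6 : 6 / (1 - η₀) = 6 * (1 / (1 - η₀)) := by ring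
  have ediv : ∀ y : ℝ, y / (1 - η₀) = y * (1 / (1 - η₀)) := fun y => by ring
  rw [e5, ediv] at i1
  rw [e6]
  generalize broadState T η₀ r A t ω = s at *
  generalize estimatedRegret u T η₀ r A t ω = G at *
  generalize totalVar T η₀ r A t ω = W at *
  generalize k * Real.log T = Q at *
  generalize 1 / (1 - η₀) = c at *
  have h2 : s.η * s.V * c ≤ c * Q / s.η := by
    have e1 := mul_le_mul_of_nonneg_left i4 (mul_pos hη hc0).le
    have e2 : s.η * c * (Q / (3 * s.η ^ 2)) = c * Q / s.η / 3 := by field_simp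
    have e3 : 0 ≤ c * Q / s.η := by positivity
    linarith
  have h3 : G ≤ (2 + 6 * c) * (Q / s.η) := by
    have : (2 + 6 * c) * (Q / s.η) = c * Q / s.η + (2 + 5 * c) * Q / s.η := by ring
    linarith
  refine h3.trans (mul_le_mul_of_nonneg_left ?_ (by positivity))
  have h4 : 0 ≤ 3 * Q / μ := by positivity
  rcases i3 with i3 | i3
  · rw [i3]
    have := mul_nonneg hμ.le hW
    linarith
  · have h5 : 0 ≤ Q / η₀ := by positivity
    have h6 := mul_le_mul_of_nonneg_left i3 hμ.le
    -- The arithmetic-geometric mean inequality, instead of a square root of the variance, keeps the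
    -- bound linear in `totalVar`.
    have h7 : Q / s.η ≤ μ * (Q / (12 * s.η ^ 2)) + 3 * Q / μ := by
      have : μ * (Q / (12 * s.η ^ 2)) + 3 * Q / μ - Q / s.η
          = Q * (μ - 6 * s.η) ^ 2 / (12 * s.η ^ 2 * μ) := by
        field_simp
        ring
      have : 0 ≤ Q * (μ - 6 * s.η) ^ 2 / (12 * s.η ^ 2 * μ) := by positivity
      linarith
    linarith

end Broad

/-! ### Measurability of BROAD -/

section BroadMeasurable

variable {k : ℕ} {Ω : Type*}

lemma measurableSet_arm_eq {m : MeasurableSpace Ω} {a : Ω → Fin k} (ha : Measurable a)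
    (b : Fin k) : MeasurableSet {ω | b = a ω} := by
  simpa [Set.preimage, eq_comm] using ha (measurableSet_singleton b)

lemma measurable_logBarrierUpdate {m : MeasurableSpace Ω} {p : Ω → Fin k → ℝ} {η x γ : Ω → ℝ}
    {a : Ω → Fin k} (hp : ∀ b, Measurable fun ω => p ω b) (hη : Measurable η)
    (hx : Measurable x) (ha : Measurable a) (hγ : Measurable γ) (b : Fin k) :
    Measurable fun ω => logBarrierUpdate (p ω) (η ω) (a ω) (x ω) (γ ω) b := by
  unfold logBarrierUpdate
  exact (hp b).div ((measurable_const.sub (Measurable.ite (measurableSet_arm_eq ha b) (hη.mul hx)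
    measurable_const)).add (hγ.mul (hp b)))

lemma measurable_normalizer {m : MeasurableSpace Ω} {p : Ω → Fin k → ℝ} {η x : Ω → ℝ}
    {a : Ω → Fin k} (hp : ∀ b, Measurable fun ω => p ω b) (hη : Measurable η)
    (hx : Measurable x) (ha : Measurable a) (hpos : ∀ ω b, 0 < p ω b)
    (hsum : ∀ ω, ∑ b, p ω b = 1) (h0 : ∀ ω, 0 ≤ η ω * x ω) (h1 : ∀ ω, η ω * x ω < 1) :
    Measurable fun ω => normalizer (p ω) (η ω) (a ω) (x ω) := by
  refine measurable_of_Iio fun c => ?_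
  by_cases hc : 0 ≤ c
  · have : (fun ω => normalizer (p ω) (η ω) (a ω) (x ω)) ⁻¹' Set.Iio c
        = {ω | ∑ b, logBarrierUpdate (p ω) (η ω) (a ω) (x ω) c b < 1} := by
      ext ω
      exact normalizer_lt_iff (hpos ω) (hsum ω) (h0 ω) (h1 ω) hc
    rw [this]
    exact measurableSet_lt (Finset.measurable_sum _ fun b _ =>
      measurable_logBarrierUpdate hp hη hx ha measurable_const b) measurable_const
  · have : (fun ω => normalizer (p ω) (η ω) (a ω) (x ω)) ⁻¹' Set.Iio c = ∅ := by
      ext ω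
      have := (normalizer_spec (a := a ω) (hpos ω) (hsum ω) (h0 ω) (h1 ω)).1
      simp only [Set.mem_preimage, Set.mem_Iio, Set.mem_empty_iff_false, iff_false]
      intro h
      linarith
    rw [this]
    exact MeasurableSet.empty

lemma measurable_estimateVar {m : MeasurableSpace Ω} {p : Ω → Fin k → ℝ} {x : Ω → ℝ}
    {a : Ω → Fin k} (hp : ∀ b, Measurable fun ω => p ω b) (hx : Measurable x)
    (ha : Measurable a) : Measurable fun ω => estimateVar (p ω) (a ω) (x ω) := by
  unfold estimateVar rewardEstimate
  exact Finset.measurable_sum _ fun b _ => ((hp b).pow_const 2).mul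
    (((Measurable.ite (measurableSet_arm_eq ha b) (hx.div (hp b)) measurable_const).sub
      hx).pow_const 2)

/-- Componentwise measurability of a random state of BROAD. -/
structure MeasurableBroad (m : MeasurableSpace Ω) (s : Ω → BROADState k) : Prop where
  p : ∀ b, Measurable fun ω => (s ω).p b
  η : Measurable fun ω => (s ω).η
  V : Measurable fun ω => (s ω).V

lemma MeasurableBroad.mono {m m' : MeasurableSpace Ω} {s : Ω → BROADState k}
    (hs : MeasurableBroad m s) (h : m ≤ m') : MeasurableBroad m' s :=
  ⟨fun b => (hs.p b).mono h le_rfl, hs.η.mono h le_rfl, hs.V.mono h le_rfl⟩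

lemma MeasurableBroad.ite {m : MeasurableSpace Ω} {s s' : Ω → BROADState k} {c : Ω → Prop}
    [DecidablePred c] (hc : MeasurableSet {ω | c ω}) (hs : MeasurableBroad m s)
    (hs' : MeasurableBroad m s') : MeasurableBroad m fun ω => if c ω then s ω else s' ω := by
  refine ⟨fun b => ?_, ?_, ?_⟩
  · simpa only [apply_ite BROADState.p, apply_ite (fun q : Fin k → ℝ => q b)]
      using Measurable.ite hc (hs.p b) (hs'.p b)
  · simpa only [apply_ite BROADState.η] using Measurable.ite hc hs.η hs'.η
  · simpa only [apply_ite BROADState.V] using Measurable.ite hc hs.V hs'.V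

variable {T : ℕ} {η₀ : ℝ} {r : ℕ → Fin k → Ω → ℝ} {A : ℕ → Ω → Fin k}

open Classical in
lemma measurable_broadState (hk : 0 < k) (h0 : 0 < η₀) (h1 : η₀ < 1) :
    ∀ t, MeasurableBroad (pastSigma r A t) (broadState T η₀ r A t)
  | 0 => by
    unfold broadState BanditAlgorithm.stateAt
    exact ⟨fun _ => measurable_const, measurable_const, measurable_const⟩
  | t + 1 => by
    have ih := (measurable_broadState hk h0 h1 t).mono (pastSigma_mono (r := r) (A := A) t.le_succ)
    have hx : Measurable[pastSigma r A (t + 1)] (playedReward r A t) :=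
      measurable_playedReward_past t
    have ha := measurable_arm_past (r := r) (A := A) t
    have hv := fun ω => broadState_valid (T := T) (r := r) (A := A) hk h0 h1 ω t
    have hb := fun ω => (hv ω).step_bounds h1 (playedReward_nonneg (r := r) (A := A) t ω)
      (playedReward_le_one t ω)
    have hn := measurable_normalizer ih.p ih.η hx ha (fun ω => (hv ω).p_pos)
      (fun ω => (hv ω).p_sum) (fun ω => (hb ω).1) (fun ω => (hb ω).2)
    have hvar := measurable_estimateVar ih.p hx ha
    have hset : MeasurableSet[pastSigma r A (t + 1)] {ω | broadRestarts T (broadState T η₀ r A t ω)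
        (A t ω) (playedReward r A t ω)} :=
      measurableSet_le (measurable_const.div (measurable_const.mul (ih.η.pow_const 2)))
        (Measurable.add ih.V hvar)
    exact MeasurableBroad.ite hset
      ⟨fun _ => measurable_const, Measurable.div ih.η measurable_const, measurable_const⟩
      ⟨fun b => measurable_logBarrierUpdate ih.p ih.η hx ha hn b, ih.η, Measurable.add ih.V hvar⟩

lemma broad_regular (hk : 0 < k) (h0 : 0 < η₀) (h1 : η₀ < 1) : (BROAD k T η₀).Regular r A where
  measurable_prob t a := (measurable_broadState hk h0 h1 t).p a
  prob_nonneg t a ω := ((broadState_valid hk h0 h1 ω t).p_pos a).le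
  sum_prob t ω := (broadState_valid hk h0 h1 ω t).p_sum

end BroadMeasurable

/-! ### The comparator -/

/-- The vertex `a` of the simplex, moved slightly towards the uniform distribution. -/
def smoothedVertex {k : ℕ} (T : ℕ) (a b : Fin k) : ℝ :=
  (1 - 1 / (T : ℝ)) * (if b = a then 1 else 0) + 1 / (k * T : ℝ)

section Comparator

variable {k T : ℕ}

lemma smoothedVertex_ge (hT : 2 ≤ T) (a b : Fin k) : 1 / (k * T : ℝ) ≤ smoothedVertex T a b := by
  have hT' : (2 : ℝ) ≤ T := by exact_mod_cast hT
  have : 1 / (T : ℝ) ≤ 1 := by rw [div_le_one (by linarith)]; linarith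
  unfold smoothedVertex
  split_ifs <;> linarith

lemma smoothedVertex_pos (hT : 2 ≤ T) (a b : Fin k) : 0 < smoothedVertex T a b := by
  have hk : (0 : ℝ) < k := by exact_mod_cast a.pos
  have hT' : (0 : ℝ) < T := by exact_mod_cast (by omega : 0 < T)
  exact lt_of_lt_of_le (by positivity) (smoothedVertex_ge hT a b)

lemma sum_smoothedVertex_mul (a : Fin k) (f : Fin k → ℝ) :
    ∑ b, smoothedVertex T a b * f b
      = (1 - 1 / (T : ℝ)) * f a + 1 / (k * T : ℝ) * ∑ b, f b := by
  simp [smoothedVertex, add_mul, Finset.sum_add_distrib, ← Finset.mul_sum]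

lemma sum_smoothedVertex (hT : 2 ≤ T) (a : Fin k) : ∑ b, smoothedVertex T a b = 1 := by
  have hk : (0 : ℝ) < k := by exact_mod_cast a.pos
  have hT' : (0 : ℝ) < T := by exact_mod_cast (by omega : 0 < T)
  have h := sum_smoothedVertex_mul (T := T) a (fun _ => 1)
  simp only [mul_one] at h
  rw [h, Finset.sum_const, Finset.card_univ, Fintype.card_fin, nsmul_eq_mul]
  field_simp
  ring

/-- The linear parts cancel since both vectors sum to one, and each coordinate is at least `1 / (k
T)`. At a true vertex the logarithms would diverge, hence the smoothing. -/
lemma logBarrierDiv_smoothedVertex_le (hT : 2 ≤ T) (a : Fin k) :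
    logBarrierDiv (smoothedVertex T a) (fun _ => 1 / (k : ℝ)) ≤ k * Real.log T := by
  have hk : (0 : ℝ) < k := by exact_mod_cast a.pos
  have hT' : (0 : ℝ) < T := by exact_mod_cast (by omega : 0 < T)
  have h : ∀ b, smoothedVertex T a b / (1 / (k : ℝ)) - 1
      - Real.log (smoothedVertex T a b / (1 / (k : ℝ)))
      ≤ k * smoothedVertex T a b - 1 + Real.log T := by
    intro b
    have e1 : smoothedVertex T a b / (1 / (k : ℝ)) = k * smoothedVertex T a b := by
      field_simp
    have e2 : 1 / (T : ℝ) ≤ k * smoothedVertex T a b := by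
      have := mul_le_mul_of_nonneg_left (smoothedVertex_ge hT a b) hk.le
      have e : (k : ℝ) * (1 / (k * T)) = 1 / T := by field_simp
      linarith
    have e3 := Real.log_le_log (by positivity) e2
    rw [one_div, Real.log_inv] at e3
    rw [e1]
    linarith
  refine (Finset.sum_le_sum fun b _ => h b).trans (le_of_eq ?_)
  rw [Finset.sum_add_distrib, Finset.sum_sub_distrib, ← Finset.mul_sum, sum_smoothedVertex hT]
  simp

end Comparator

/-! ### Expected regret of BROAD -/

namespace IsRun

variable {k : ℕ} {Ω : Type*} [mΩ : MeasurableSpace Ω] {P : Measure Ω} [IsProbabilityMeasure P]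
  {B : StochasticBandit k} {T : ℕ} {η₀ : ℝ}
  {r : ℕ → Fin k → Ω → ℝ} {A : ℕ → Ω → Fin k}

lemma broad_integral_round (h : IsRun P B (BROAD k T η₀) T r A) (hk : 0 < k) (h0 : 0 < η₀)
    (h1 : η₀ < 1) {t : ℕ} (ht : t < T) {g : Fin k → Ω → ℝ}
    (hg : ∀ a, Measurable[pastSigma r A t] (g a)) {K : ℝ} (hgK : ∀ a ω, |g a ω| ≤ K) :
    Integrable (fun ω => g (A t ω) ω * playedReward r A t ω) P ∧
    ∫ ω, g (A t ω) ω * playedReward r A t ω ∂P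
      = ∑ a, (∫ ω, g a ω * (broadState T η₀ r A t ω).p a ∂P) * B.mean a := by
  constructor
  · refine (h.integrable_playedReward t).bdd_mul (c := K) (Measurable.aestronglyMeasurable ?_)
      (.of_forall fun ω => by simpa using hgK (A t ω) ω)
    exact measurable_select (h.measurable_arm t)
      fun a => (hg a).mono (h.pastSigma_le t) le_rfl
  · exact h.integral_round ht ((broad_regular hk h0 h1).measurable_prob t) hg hgK
      (f := fun _ x => x) (fun _ => measurable_id)
      (M := 1) (fun _ x hx => abs_le.2 ⟨by linarith [hx.1], hx.2⟩)

/-- Importance weighting is unbiased: the probability of the pulled arm cancels its inverse in the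
estimate. -/
lemma broad_integral_estimatedRegret (h : IsRun P B (BROAD k T η₀) T r A) (hk : 0 < k)
    (h0 : 0 < η₀) (h1 : η₀ < 1) (u : Fin k → ℝ) {K : ℝ} (hu : ∀ b, |u b| ≤ K) :
    Integrable (estimatedRegret u T η₀ r A T) P ∧
    ∫ ω, estimatedRegret u T η₀ r A T ω ∂P = ∑ t ∈ Finset.range T,
      (∑ a, u a * B.mean a - ∑ a, (∫ ω, (broadState T η₀ r A t ω).p a ∂P) * B.mean a) := by
  have hR := broad_regular (T := T) (r := r) (A := A) hk h0 h1
  have hround : ∀ t ∈ Finset.range T,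
      Integrable (fun ω => u (A t ω) * playedReward r A t ω / (broadState T η₀ r A t ω).p (A t ω)
        - playedReward r A t ω) P ∧
      ∫ ω, (u (A t ω) * playedReward r A t ω / (broadState T η₀ r A t ω).p (A t ω)
        - playedReward r A t ω) ∂P
        = ∑ a, u a * B.mean a
          - ∑ a, (∫ ω, (broadState T η₀ r A t ω).p a ∂P) * B.mean a := by
    intro t ht
    have ht := Finset.mem_range.1 ht
    have hv := fun ω => broadState_valid (T := T) (r := r) (A := A) hk h0 h1 ω t
    have hm := measurable_broadState (T := T) (r := r) (A := A) hk h0 h1 t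
    obtain ⟨i1, i2⟩ := h.broad_integral_round hk h0 h1 ht
      (g := fun a ω => u a / (broadState T η₀ r A t ω).p a)
      (fun a => Measurable.div measurable_const (hm.p a)) (K := K * (k * (t + 1)))
      (fun a ω => by
        have hp := (hv ω).p_pos a
        rw [abs_div, abs_of_pos hp, div_eq_mul_one_div]
        exact mul_le_mul (hu a) ((hv ω).inv_p_le a) (by positivity) ((abs_nonneg _).trans (hu a)))
    have e1 : ∀ ω, u (A t ω) / (broadState T η₀ r A t ω).p (A t ω) * playedReward r A t ω
        = u (A t ω) * playedReward r A t ω / (broadState T η₀ r A t ω).p (A t ω) :=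
      fun ω => by ring
    have e2 : ∀ a, ∫ ω, u a / (broadState T η₀ r A t ω).p a * (broadState T η₀ r A t ω).p a ∂P
        = u a := by
      intro a
      have : ∀ ω, u a / (broadState T η₀ r A t ω).p a * (broadState T η₀ r A t ω).p a = u a :=
        fun ω => div_mul_cancel₀ _ ((hv ω).p_pos a).ne'
      simp [this]
    simp only [e1, e2] at i1 i2
    have i3 : Integrable (playedReward r A t) P := h.integrable_playedReward t
    refine ⟨i1.sub i3, ?_⟩
    rw [integral_sub i1 i3, i2]
    congr 1
    exact h.integral_playedReward hR ht
  refine ⟨integrable_finsetSum _ fun t ht => (hround t ht).1, ?_⟩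
  unfold estimatedRegret
  rw [integral_finsetSum _ fun t ht => (hround t ht).1]
  exact Finset.sum_congr rfl fun t ht => (hround t ht).2

lemma broad_integral_totalVar (h : IsRun P B (BROAD k T η₀) T r A) (hk : 0 < k)
    (h0 : 0 < η₀) (h1 : η₀ < 1) (c : Fin k) :
    Integrable (totalVar T η₀ r A T) P ∧
    ∫ ω, totalVar T η₀ r A T ω ∂P ≤ ∑ t ∈ Finset.range T,
      4 * B.bestMean * (1 - ∫ ω, (broadState T η₀ r A t ω).p c ∂P) := by
  have hR := broad_regular (T := T) (r := r) (A := A) hk h0 h1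
  have hround : ∀ t ∈ Finset.range T,
      Integrable (fun ω => estimateVar (broadState T η₀ r A t ω).p (A t ω)
        (playedReward r A t ω)) P ∧
      ∫ ω, estimateVar (broadState T η₀ r A t ω).p (A t ω) (playedReward r A t ω) ∂P
        ≤ 4 * B.bestMean * (1 - ∫ ω, (broadState T η₀ r A t ω).p c ∂P) := by
    intro t ht
    have ht := Finset.mem_range.1 ht
    have hv := fun ω => broadState_valid (T := T) (r := r) (A := A) hk h0 h1 ω t
    have hm := measurable_broadState (T := T) (r := r) (A := A) hk h0 h1 t
    have hple := fun ω => le_one_of_sum_eq_one (hv ω).p_pos (hv ω).p_sum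
    have hpi : ∀ a, Integrable (fun ω => (broadState T η₀ r A t ω).p a) P :=
      fun a => h.integrable_prob hR t a
    obtain ⟨i1, i2⟩ := h.broad_integral_round hk h0 h1 ht
      (g := fun a ω => 2 * (1 - (broadState T η₀ r A t ω).p a))
      (fun a => Measurable.mul measurable_const (Measurable.sub measurable_const (hm.p a))) (K := 2)
      (fun a ω => by
        have hp := (hv ω).p_pos a
        have hp1 := hple ω a
        rw [abs_of_nonneg (by linarith)]
        linarith)
    have hle : ∀ ω, estimateVar (broadState T η₀ r A t ω).p (A t ω) (playedReward r A t ω)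
        ≤ 2 * (1 - (broadState T η₀ r A t ω).p (A t ω)) * playedReward r A t ω := fun ω =>
      estimateVar_le (hv ω).p_pos (hv ω).p_sum (playedReward_nonneg t ω) (playedReward_le_one t ω)
    have i3 : Integrable (fun ω => estimateVar (broadState T η₀ r A t ω).p (A t ω)
        (playedReward r A t ω)) P := by
      have hm' := hm.mono (h.pastSigma_le t)
      refine i1.mono' (measurable_estimateVar hm'.p (h.measurable_playedReward t)
        (h.measurable_arm t)).aestronglyMeasurable (.of_forall fun ω => ?_)
      rw [Real.norm_eq_abs, abs_of_nonneg estimateVar_nonneg]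
      exact hle ω
    refine ⟨i3, (integral_mono i3 i1 hle).trans (i2.trans_le ?_)⟩
    have hI : ∀ a, Integrable (fun ω => 2 * (1 - (broadState T η₀ r A t ω).p a)
        * (broadState T η₀ r A t ω).p a) P := by
      intro a
      refine (hpi a).bdd_mul (c := 2) (Measurable.aestronglyMeasurable ?_) (.of_forall fun ω => ?_)
      · exact measurable_const.mul (measurable_const.sub ((hm.p a).mono (h.pastSigma_le t) le_rfl))
      · have hp := (hv ω).p_pos a
        have hp1 := hple ω a
        rw [Real.norm_eq_abs, abs_of_nonneg (by linarith)]
        linarith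
    have s1 : ∀ a, (∫ ω, 2 * (1 - (broadState T η₀ r A t ω).p a)
        * (broadState T η₀ r A t ω).p a ∂P) * B.mean a
        ≤ (∫ ω, 2 * (1 - (broadState T η₀ r A t ω).p a)
          * (broadState T η₀ r A t ω).p a ∂P) * B.bestMean := fun a =>
      mul_le_mul_of_nonneg_left (B.mean_le_bestMean a) (integral_nonneg fun ω => by
        have hp := (hv ω).p_pos a
        have hp1 := hple ω a
        exact mul_nonneg (by linarith) hp.le)
    refine (Finset.sum_le_sum fun a _ => s1 a).trans ?_
    rw [← Finset.sum_mul, ← integral_finsetSum _ fun a _ => hI a]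
    have s2 : ∫ ω, ∑ a, 2 * (1 - (broadState T η₀ r A t ω).p a) * (broadState T η₀ r A t ω).p a ∂P
        ≤ ∫ ω, 4 * (1 - (broadState T η₀ r A t ω).p c) ∂P := by
      refine integral_mono (integrable_finsetSum _ fun a _ => hI a)
        (((integrable_const 1).sub (hpi c)).const_mul 4) fun ω => ?_
      -- For `a ≠ c` drop the factor `1 - p a`; for `a = c` drop `p c`. Either part sums to `2 (1 -
      -- p c)`.
      have e1 : ∀ a, 2 * (1 - (broadState T η₀ r A t ω).p a) * (broadState T η₀ r A t ω).p a
          ≤ 2 * (broadState T η₀ r A t ω).p a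
            + if a = c then 2 - 4 * (broadState T η₀ r A t ω).p c else 0 := by
        intro a
        have hp := (hv ω).p_pos a
        have hp1 := hple ω a
        split_ifs with hac
        · subst hac
          nlinarith
        · nlinarith
      refine (Finset.sum_le_sum fun a _ => e1 a).trans (le_of_eq ?_)
      rw [Finset.sum_add_distrib, ← Finset.mul_sum, (hv ω).p_sum]
      simp
      ring
    rw [integral_const_mul, integral_sub (integrable_const 1) (hpi c)] at s2
    have s3 := mul_le_mul_of_nonneg_right s2 (B.bestMean_nonneg hk)
    simp only [integral_const, probReal_univ, smul_eq_mul, mul_one] at s3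
    linarith
  refine ⟨integrable_finsetSum _ fun t ht => (hround t ht).1, ?_⟩
  unfold totalVar
  rw [integral_finsetSum _ fun t ht => (hround t ht).1]
  exact Finset.sum_le_sum fun t ht => (hround t ht).2

end IsRun

/-! ### Self-bounding of the regret of BROAD. -/

lemma StochasticBandit.gap_le_one {k : ℕ} (B : StochasticBandit k) (hk : 0 < k) (a : Fin k) :
    B.gap a ≤ 1 := (B.gap_le_bestMean a).trans (B.bestMean_le_one hk)

/-- One summand of the regret bound is a lower bound for the whole. -/
lemma StochasticBandit.log_div_gap_le_sum {k : ℕ} (B : StochasticBandit k) {b : Fin k}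
    (hb : 0 < B.gap b) (T : ℕ) :
    Real.log T / B.gap b ≤ ∑ a with 0 < B.gap a, Real.log T / B.gap a :=
  Finset.single_le_sum (f := fun a => Real.log T / B.gap a)
    (fun _ ha => div_nonneg (Real.log_natCast_nonneg T) (Finset.mem_filter.1 ha).2.le)
    (Finset.mem_filter.2 ⟨Finset.mem_univ b, hb⟩)

/-- Absorbs `X / 2`. The terms without `1 / D` fit into `th * (L / D)` because `D ≤ th`, `D ≤ 1` and
`L ≥ 1/2`. -/
lemma broad_final_arith {X D th Q L β η₀ k : ℝ} (hD : 0 < D) (hD1 : D ≤ 1) (hDth : D ≤ th)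
    (hL : 1 / 2 ≤ L) (hQ : Q = k * L) (hk : 0 ≤ k) (hβ : 0 < β) (hη : 0 < η₀)
    (hX : X ≤ th + (β * (Q / η₀ + 3 * Q / (D / (8 * β * th))) + X / 2)) :
    X ≤ (4 + 2 * β * k / η₀ + 48 * β ^ 2 * k) * (th * (L / D)) := by
  have hth : 0 < th := hD.trans_le hDth
  have e1 : 3 * Q / (D / (8 * β * th)) = 24 * β * k * (th * (L / D)) := by
    rw [hQ]
    field_simp
    ring
  have e2 : Q / η₀ ≤ k / η₀ * (th * (L / D)) := by
    have : L ≤ th * (L / D) := by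
      rw [mul_div_assoc', le_div_iff₀ hD]
      nlinarith
    rw [hQ, mul_div_right_comm]
    exact mul_le_mul_of_nonneg_left this (by positivity)
  have e3 : th ≤ 2 * (th * (L / D)) := by
    rw [mul_div_assoc', mul_div_assoc', le_div_iff₀ hD]
    nlinarith
  rw [e1] at hX
  have e4 := mul_le_mul_of_nonneg_left e2 hβ.le
  have e5 : (4 + 2 * β * k / η₀ + 48 * β ^ 2 * k) * (th * (L / D))
      = 2 * (2 * (th * (L / D))) + 2 * (β * (k / η₀ * (th * (L / D))))
        + 2 * (β * (24 * β * k * (th * (L / D)))) := by ring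
  rw [e5]
  linarith

/-- The regret bound for BROAD. -/
lemma IsRun.broad_pseudoRegret_le {k : ℕ} {Ω : Type*} [MeasurableSpace Ω] {P : Measure Ω}
    [IsProbabilityMeasure P] {B : StochasticBandit k} {T : ℕ} {η₀ : ℝ}
    {r : ℕ → Fin k → Ω → ℝ} {A : ℕ → Ω → Fin k} (h : IsRun P B (BROAD k T η₀) T r A)
    (hk : 0 < k) (h0 : 0 < η₀) (h1 : η₀ < 1) (hT : 2 ≤ T)
    (huniq : ∃ c, ∀ a, a ≠ c → B.mean a < B.mean c) :
    pseudoRegret P T r A ≤ (4 + 2 * (2 + 6 / (1 - η₀)) * k / η₀ + 48 * (2 + 6 / (1 - η₀)) ^ 2 * k)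
      * (B.bestMean * ∑ a with 0 < B.gap a, Real.log T / B.gap a) := by
  have hR := broad_regular (T := T) (r := r) (A := A) hk h0 h1
  have hreg := h.pseudoRegret_le hk hR
  set q : ℕ → Fin k → ℝ := fun t a => ∫ ω, (broadState T η₀ r A t ω).p a ∂P with hq
  have hqsum : ∀ t, ∑ a, q t a = 1 := h.sum_integral_prob hR
  have hq0 : ∀ t a, 0 ≤ q t a := fun t a => integral_nonneg (hR.prob_nonneg t a)
  change pseudoRegret P T r A ≤ ∑ t ∈ Finset.range T, ∑ a, q t a * B.gap a at hreg
  set X := ∑ t ∈ Finset.range T, ∑ a, q t a * B.gap a with hX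
  refine hreg.trans ?_
  obtain ⟨c, hc⟩ := huniq
  have hbest : B.bestMean = B.mean c := by
    obtain ⟨a, ha⟩ := B.exists_mean_eq_bestMean hk
    rcases eq_or_ne a c with rfl | hac
    · exact ha.symm
    · have := hc a hac
      have := B.mean_le_bestMean c
      linarith
  have hgapc : B.gap c = 0 := by rw [StochasticBandit.gap, hbest, sub_self]
  have hgap : ∀ a, a ≠ c → 0 < B.gap a := fun a ha => by
    rw [StochasticBandit.gap, hbest]
    exact sub_pos.2 (hc a ha)
  have hη1 : 0 < 1 - η₀ := by linarith
  set β := 2 + 6 / (1 - η₀) with hβdef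
  have hβ : 0 < β := by positivity
  have hlog := half_le_log hT
  by_cases hne : (Finset.univ.filter fun a => 0 < B.gap a).Nonempty
  swap
  · rw [Finset.not_nonempty_iff_eq_empty] at hne
    rw [hne, Finset.sum_empty, mul_zero, mul_zero]
    refine Finset.sum_nonpos fun t _ => Finset.sum_nonpos fun a _ => ?_
    have ha : a ∉ Finset.univ.filter fun a => 0 < B.gap a := by rw [hne]; simp
    have : B.gap a ≤ 0 := by simpa using ha
    exact mul_nonpos_of_nonneg_of_nonpos (hq0 t a) this
  obtain ⟨b, hb, hbmin⟩ := Finset.exists_min_image _ B.gap hne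
  have hb0 : 0 < B.gap b := (Finset.mem_filter.1 hb).2
  have hD := B.gap_le_bestMean b
  have hth : 0 < B.bestMean := hb0.trans_le hD
  -- Chosen so that `β * μ * (4 * bestMean / gap b) = 1 / 2`, with `b` the arm of smallest positive
  -- gap.
  set μ := B.gap b / (8 * β * B.bestMean) with hμdef
  have hμ : 0 < μ := by positivity
  have hupos := smoothedVertex_pos (k := k) hT c
  have husum := sum_smoothedVertex hT c
  have hu1 : ∀ a, |smoothedVertex T c a| ≤ 1 := fun a => by
    rw [abs_of_pos (hupos a)]
    exact le_one_of_sum_eq_one hupos husum a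
  obtain ⟨iG, eG⟩ := h.broad_integral_estimatedRegret hk h0 h1 (smoothedVertex T c) hu1
  obtain ⟨iV, eV⟩ := h.broad_integral_totalVar hk h0 h1 c
  have hpath := integral_mono iG ((((integrable_const (k * Real.log T / η₀)).add
    (iV.const_mul μ)).add (integrable_const (3 * (k * Real.log T) / μ))).const_mul β)
    fun ω => estimatedRegret_le (r := r) (A := A) hk h0 h1 hT hupos husum
      (logBarrierDiv_smoothedVertex_le hT c) hμ T ω
  have hpath' : ∫ ω, estimatedRegret (smoothedVertex T c) T η₀ r A T ω ∂P
      ≤ β * (k * Real.log T / η₀ + μ * ∫ ω, totalVar T η₀ r A T ω ∂P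
        + 3 * (k * Real.log T) / μ) := by
    refine hpath.trans (le_of_eq ?_)
    rw [integral_const_mul, integral_add' ((integrable_const _).add (iV.const_mul μ))
      (integrable_const _), integral_add' (integrable_const _) (iV.const_mul μ), integral_const_mul]
    simp
  have hTpos : (0 : ℝ) < T := by exact_mod_cast (by omega : 0 < T)
  -- Smoothing the comparator costs at most `bestMean / T` in each of the `T` rounds.
  have hXG : X ≤ B.bestMean + ∫ ω, estimatedRegret (smoothedVertex T c) T η₀ r A T ω ∂P := by
    rw [eG]
    have e1 : ∀ t, ∑ a, q t a * B.gap a = B.bestMean - ∑ a, q t a * B.mean a := by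
      intro t
      simp only [StochasticBandit.gap, mul_sub, Finset.sum_sub_distrib]
      rw [← Finset.sum_mul, hqsum t, one_mul]
    have e2 : (1 - 1 / (T : ℝ)) * B.bestMean ≤ ∑ a, smoothedVertex T c a * B.mean a := by
      rw [sum_smoothedVertex_mul, hbest]
      have : 0 ≤ 1 / (k * T : ℝ) * ∑ a, B.mean a :=
        mul_nonneg (by positivity) (Finset.sum_nonneg fun a _ => B.mean_nonneg a)
      linarith
    have e3 : ∀ t ∈ Finset.range T, ∑ a, q t a * B.gap a
        ≤ (∑ a, smoothedVertex T c a * B.mean a - ∑ a, q t a * B.mean a)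
          + 1 / (T : ℝ) * B.bestMean := by
      intro t _
      rw [e1]
      linarith
    refine (Finset.sum_le_sum e3).trans (le_of_eq ?_)
    rw [Finset.sum_add_distrib, Finset.sum_const, Finset.card_range, nsmul_eq_mul, add_comm]
    congr 1
    field_simp
  have hvar : μ * ∫ ω, totalVar T η₀ r A T ω ∂P ≤ X / (2 * β) := by
    have e1 : ∑ t ∈ Finset.range T, 4 * B.bestMean * (1 - q t c)
        ≤ 4 * B.bestMean / B.gap b * X := by
      rw [hX, Finset.mul_sum]
      refine Finset.sum_le_sum fun t _ => ?_
      -- Uniqueness of the best arm enters here: all mass away from `c` pays at least the smallest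
      -- gap.
      have e2 : B.gap b * (1 - q t c) ≤ ∑ a, q t a * B.gap a := by
        have e3 : ∀ a, B.gap b * (q t a - if a = c then q t c else 0) ≤ q t a * B.gap a := by
          intro a
          split_ifs with hac
          · subst hac
            rw [hgapc]
            simp
          · have := hbmin a (Finset.mem_filter.2 ⟨Finset.mem_univ a, hgap a hac⟩)
            nlinarith [hq0 t a]
        refine le_trans (le_of_eq ?_) (Finset.sum_le_sum fun a _ => e3 a)
        rw [← Finset.mul_sum, Finset.sum_sub_distrib, hqsum]
        simp
      calc 4 * B.bestMean * (1 - q t c)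
          = 4 * B.bestMean / B.gap b * (B.gap b * (1 - q t c)) := by field_simp
        _ ≤ _ := mul_le_mul_of_nonneg_left e2 (by positivity)
    refine (mul_le_mul_of_nonneg_left (eV.trans e1) hμ.le).trans (le_of_eq ?_)
    rw [hμdef]
    field_simp
    ring
  refine (broad_final_arith (X := X) (L := Real.log T) hb0 (B.gap_le_one hk b) hD hlog rfl
    (Nat.cast_nonneg k) hβ h0 ?_).trans ?_
  · have e1 := mul_le_mul_of_nonneg_left hvar hβ.le
    have e2 : β * (X / (2 * β)) = X / 2 := by field_simp
    rw [← hμdef, mul_add]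
    rw [mul_add, mul_add] at hpath'
    linarith
  · refine mul_le_mul_of_nonneg_left (mul_le_mul_of_nonneg_left (B.log_div_gap_le_sum hb0 T)
      hth.le) ?_
    positivity

/-! ### Pathwise properties of AAEAS -/

/-- State of AAEAS at the beginning of round `t`, run on the clipped rewards. -/
def aaeasState {k : ℕ} {Ω : Type*} (T : ℕ) (δ : ℝ) (r : ℕ → Fin k → Ω → ℝ) (A : ℕ → Ω → Fin k)
    (t : ℕ) (ω : Ω) : AAEASState k :=
  (AAEAS k T δ).stateAt (clippedReward r) A t ω

/-- Sum of the inverse sizes of the active sets before round `t`. -/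
def inverseActiveSum {k : ℕ} {Ω : Type*} (T : ℕ) (δ : ℝ) (r : ℕ → Fin k → Ω → ℝ)
    (A : ℕ → Ω → Fin k) (t : ℕ) (ω : Ω) : ℝ :=
  ∑ s ∈ Finset.range t, 1 / ((aaeasState T δ r A s ω).active.card : ℝ)

lemma confidenceBound_nonneg (k : ℕ) (δ' S : ℝ) : 0 ≤ confidenceBound k δ' S := by
  unfold confidenceBound
  positivity

section Aaeas

variable {k : ℕ} {Ω : Type*} {T : ℕ} {δ : ℝ} {r : ℕ → Fin k → Ω → ℝ} {A : ℕ → Ω → Fin k}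

lemma aaeasState_zero (ω : Ω) :
    aaeasState T δ r A 0 ω = { active := Finset.univ, R := fun _ => 0, S := 0 } := rfl

lemma aaeasState_succ_S (t : ℕ) (ω : Ω) :
    (aaeasState T δ r A (t + 1) ω).S = (aaeasState T δ r A t ω).S + playedReward r A t ω := rfl

lemma aaeasState_succ_R (t : ℕ) (ω : Ω) (b : Fin k) :
    (aaeasState T δ r A (t + 1) ω).R b
      = (aaeasState T δ r A t ω).R b + if b = A t ω then playedReward r A t ω else 0 := by
  have h : (aaeasState T δ r A (t + 1) ω).R = Function.update (aaeasState T δ r A t ω).R (A t ω)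
    ((aaeasState T δ r A t ω).R (A t ω) + playedReward r A t ω) := rfl
  rw [h, Function.update_apply]
  split_ifs with hb
  · rw [hb]
  · rw [add_zero]

lemma mem_active_succ (t : ℕ) (ω : Ω) (b : Fin k) :
    b ∈ (aaeasState T δ r A (t + 1) ω).active ↔ b ∈ (aaeasState T δ r A t ω).active ∧
      ∀ c ∈ (aaeasState T δ r A t ω).active, (aaeasState T δ r A (t + 1) ω).R c
        ≤ (aaeasState T δ r A (t + 1) ω).R b
          + confidenceBound k (δ / (((k : ℝ) + 1) * T)) (aaeasState T δ r A (t + 1) ω).S := by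
  classical
  have h : (aaeasState T δ r A (t + 1) ω).active = (aaeasState T δ r A t ω).active.filter
      fun b => ¬ ∃ c ∈ (aaeasState T δ r A t ω).active, (aaeasState T δ r A (t + 1) ω).R b
        + confidenceBound k (δ / (((k : ℝ) + 1) * T)) (aaeasState T δ r A (t + 1) ω).S
        < (aaeasState T δ r A (t + 1) ω).R c := by
    ext b
    change b ∈ Finset.filter _ _ ↔ b ∈ Finset.filter _ _
    rw [Finset.mem_filter, Finset.mem_filter]
    rfl
  rw [h, Finset.mem_filter]
  push Not
  rfl

/-- The active arm with the largest collected reward survives, as the confidence bound is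
nonnegative. -/
lemma active_nonempty (hk : 0 < k) (ω : Ω) : ∀ t, (aaeasState T δ r A t ω).active.Nonempty
  | 0 => ⟨⟨0, hk⟩, Finset.mem_univ _⟩
  | t + 1 => by
    obtain ⟨b, hb, hmax⟩ := Finset.exists_max_image _ (aaeasState T δ r A (t + 1) ω).R
      (active_nonempty hk ω t)
    refine ⟨b, (mem_active_succ t ω b).2 ⟨hb, fun c hc => ?_⟩⟩
    have := hmax c hc
    have := confidenceBound_nonneg k (δ / (((k : ℝ) + 1) * T)) (aaeasState T δ r A (t + 1) ω).S
    linarith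

lemma one_le_card_active (hk : 0 < k) (t : ℕ) (ω : Ω) :
    (1 : ℝ) ≤ (aaeasState T δ r A t ω).active.card := by
  exact_mod_cast (active_nonempty hk ω t).card_pos

lemma card_active_le (t : ℕ) (ω : Ω) : ((aaeasState T δ r A t ω).active.card : ℝ) ≤ k := by
  exact_mod_cast (Finset.card_le_univ _).trans_eq (Fintype.card_fin k)

open Classical in
lemma aaeas_prob_eq (t : ℕ) (ω : Ω) (b : Fin k) :
    (AAEAS k T δ).prob ((AAEAS k T δ).stateAt (clippedReward r) A t ω) b
      = if b ∈ (aaeasState T δ r A t ω).active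
        then 1 / ((aaeasState T δ r A t ω).active.card : ℝ) else 0 := rfl

lemma aaeas_S_nonneg (ω : Ω) : ∀ t, 0 ≤ (aaeasState T δ r A t ω).S
  | 0 => le_rfl
  | t + 1 => add_nonneg (aaeas_S_nonneg ω t) (playedReward_nonneg t ω)

lemma aaeas_S_le (ω : Ω) : ∀ t, (aaeasState T δ r A t ω).S ≤ t
  | 0 => by simp [aaeasState_zero]
  | t + 1 => by
    rw [aaeasState_succ_S]
    push_cast
    exact add_le_add (aaeas_S_le ω t) (playedReward_le_one t ω)

lemma aaeas_R_nonneg (ω : Ω) (b : Fin k) : ∀ t, 0 ≤ (aaeasState T δ r A t ω).R b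
  | 0 => le_rfl
  | t + 1 => by
    rw [aaeasState_succ_R]
    refine add_nonneg (aaeas_R_nonneg ω b t) ?_
    split_ifs
    · exact playedReward_nonneg t ω
    · exact le_rfl

lemma aaeas_R_le (ω : Ω) (b : Fin k) : ∀ t, (aaeasState T δ r A t ω).R b ≤ t
  | 0 => by simp [aaeasState_zero]
  | t + 1 => by
    rw [aaeasState_succ_R]
    push_cast
    refine add_le_add (aaeas_R_le ω b t) ?_
    split_ifs
    · exact playedReward_le_one t ω
    · exact zero_le_one

lemma inverseActiveSum_nonneg (t : ℕ) (ω : Ω) : 0 ≤ inverseActiveSum T δ r A t ω :=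
  Finset.sum_nonneg fun s _ => by positivity

lemma inverseActiveSum_le (hk : 0 < k) (t : ℕ) (ω : Ω) : inverseActiveSum T δ r A t ω ≤ t := by
  have h : ∀ s ∈ Finset.range t, 1 / ((aaeasState T δ r A s ω).active.card : ℝ) ≤ 1 :=
    fun s _ => by
      have := one_le_card_active (T := T) (δ := δ) (r := r) (A := A) hk s ω
      rw [div_le_one (by linarith)]
      exact this
  exact (Finset.sum_le_sum h).trans (by simp)

lemma le_inverseActiveSum (hk : 0 < k) (t : ℕ) (ω : Ω) :
    (t : ℝ) ≤ k * inverseActiveSum T δ r A t ω := by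
  have h : ∀ s ∈ Finset.range t, 1 / (k : ℝ) ≤ 1 / ((aaeasState T δ r A s ω).active.card : ℝ) :=
    fun s _ => one_div_le_one_div_of_le
      (by linarith [one_le_card_active (T := T) (δ := δ) (r := r) (A := A) hk s ω])
      (card_active_le s ω)
  have h2 := Finset.sum_le_sum h
  have hk' : (0 : ℝ) < k := by exact_mod_cast hk
  rw [Finset.sum_const, Finset.card_range, nsmul_eq_mul, mul_one_div, div_le_iff₀ hk'] at h2
  rw [mul_comm]
  exact h2

/-! ### Measurability of AAEAS -/

/-- Componentwise measurability of a random state of AAEAS. -/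
structure MeasurableAaeas (m : MeasurableSpace Ω) (s : Ω → AAEASState k) : Prop where
  active : ∀ b, MeasurableSet {ω | b ∈ (s ω).active}
  R : ∀ b, Measurable fun ω => (s ω).R b
  S : Measurable fun ω => (s ω).S

lemma MeasurableAaeas.mono {m m' : MeasurableSpace Ω} {s : Ω → AAEASState k}
    (hs : MeasurableAaeas m s) (h : m ≤ m') : MeasurableAaeas m' s :=
  ⟨fun b => h _ (hs.active b), fun b => (hs.R b).mono h le_rfl, hs.S.mono h le_rfl⟩

open Classical in
lemma MeasurableAaeas.card {m : MeasurableSpace Ω} {s : Ω → AAEASState k}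
    (hs : MeasurableAaeas m s) : Measurable fun ω => ((s ω).active.card : ℝ) := by
  have : (fun ω => ((s ω).active.card : ℝ))
      = fun ω => ∑ b, if b ∈ (s ω).active then (1 : ℝ) else 0 := by
    funext ω
    simp
  rw [this]
  exact Finset.measurable_sum _ fun b _ => Measurable.ite (hs.active b) measurable_const
    measurable_const

lemma measurable_aaeasState : ∀ t, MeasurableAaeas (pastSigma r A t) (aaeasState T δ r A t)
  | 0 => by
    unfold aaeasState BanditAlgorithm.stateAt
    refine ⟨fun b => ?_, fun _ => measurable_const, measurable_const⟩
    simp [AAEAS]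
  | t + 1 => by
    have ih := (measurable_aaeasState t).mono (pastSigma_mono (r := r) (A := A) t.le_succ)
    have hx : Measurable[pastSigma r A (t + 1)] (playedReward r A t) :=
      measurable_playedReward_past t
    have ha := measurable_arm_past (r := r) (A := A) t
    have hS : Measurable[pastSigma r A (t + 1)] fun ω => (aaeasState T δ r A (t + 1) ω).S :=
      Measurable.add ih.S hx
    have hR : ∀ b, Measurable[pastSigma r A (t + 1)]
        fun ω => (aaeasState T δ r A (t + 1) ω).R b := by
      intro b
      simp only [aaeasState_succ_R]
      exact Measurable.add (ih.R b) (Measurable.ite (measurableSet_arm_eq ha b) hx measurable_const)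
    refine ⟨fun b => ?_, hR, hS⟩
    have hCB : Measurable[pastSigma r A (t + 1)] fun ω => confidenceBound k
        (δ / (((k : ℝ) + 1) * T)) (aaeasState T δ r A (t + 1) ω).S := by
      unfold confidenceBound
      exact measurable_const.mul ((((measurable_const.mul hS).mul measurable_const).max
        measurable_const).sqrt)
    have : {ω | b ∈ (aaeasState T δ r A (t + 1) ω).active}
        = {ω | b ∈ (aaeasState T δ r A t ω).active} ∩ ⋂ c,
          ({ω | c ∈ (aaeasState T δ r A t ω).active}ᶜ ∪ {ω | (aaeasState T δ r A (t + 1) ω).R c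
            ≤ (aaeasState T δ r A (t + 1) ω).R b + confidenceBound k (δ / (((k : ℝ) + 1) * T))
              (aaeasState T δ r A (t + 1) ω).S}) := by
      ext ω
      simp only [mem_active_succ, Set.mem_ofPred_eq, Set.mem_union, Set.mem_compl_iff,
        Set.mem_inter_iff, Set.mem_iInter, imp_iff_not_or]
    rw [this]
    exact (ih.active b).inter (MeasurableSet.iInter fun c =>
      (ih.active c).compl.union (measurableSet_le (hR c) (Measurable.add (hR b) hCB)))

lemma measurable_inverseActiveSum (t : ℕ) :
    Measurable[pastSigma r A t] (inverseActiveSum T δ r A t) := by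
  unfold inverseActiveSum
  exact Finset.measurable_sum _ fun s hs => Measurable.div measurable_const
    ((measurable_aaeasState s).mono (pastSigma_mono (Finset.mem_range.1 hs).le)).card

open Classical in
lemma aaeas_regular (hk : 0 < k) : (AAEAS k T δ).Regular r A where
  measurable_prob t a := by
    have h := measurable_aaeasState (T := T) (δ := δ) (r := r) (A := A) t
    exact Measurable.ite (h.active a) (Measurable.div measurable_const h.card) measurable_const
  prob_nonneg t a ω := by
    rw [aaeas_prob_eq]
    split_ifs <;> positivity
  sum_prob t ω := by
    simp only [aaeas_prob_eq]
    have := one_le_card_active (T := T) (δ := δ) (r := r) (A := A) hk t ω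
    rw [Finset.sum_ite_mem, Finset.univ_inter, Finset.sum_const, nsmul_eq_mul, mul_one_div_cancel]
    linarith

end Aaeas

/-! ### Exponential supermartingales for AAEAS -/

/-- A Bernstein bound in which the reward itself plays the role of the variance; `ε` is the sign
with which it enters `R b - R c`. The right-hand side is linear in `x`, so integrating it involves
only the mean. -/
lemma exp_bernstein_le {lam ε x : ℝ} (h0 : 0 ≤ lam) (h1 : lam ≤ 2 / 5)
    (hε : ε = -1 ∨ ε = 0 ∨ ε = 1) (hx0 : 0 ≤ x) (hx1 : x ≤ 1) :
    Real.exp ((lam * ε - lam ^ 2) * x) ≤ 1 + lam * ε * x := by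
  rcases hε with rfl | rfl | rfl
  · set y := lam * x with hy
    have hy0 : 0 ≤ y := mul_nonneg h0 hx0
    have hy1 : y ≤ lam := by nlinarith
    set v := y * (1 + lam) with hv
    have hv0 : 0 ≤ v := mul_nonneg hy0 (by linarith)
    have e1 : (lam * -1 - lam ^ 2) * x = -v := by rw [hv, hy]; ring
    have e2 := Real.quadratic_le_exp_of_nonneg hv0
    -- For the negative sign the claim is `1 ≤ (1 - y) * exp v`; the quadratic lower bound for `exp
    -- v` already suffices when `lam ≤ 2/5`.
    have e3 : 1 ≤ (1 - y) * (1 + v + v ^ 2 / 2) := by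
      have f1 : (1 - y) * (1 + v + v ^ 2 / 2) - 1
          = y * (lam - y * (1 - lam ^ 2) / 2 - y ^ 2 * (1 + lam) ^ 2 / 2) := by
        rw [hv]; ring
      have f2 : y * (1 - lam ^ 2) ≤ lam := by nlinarith [mul_nonneg hy0 (sq_nonneg lam)]
      have f3 : y ^ 2 * (1 + lam) ^ 2 ≤ lam := by
        have g1 : y ^ 2 ≤ lam * (2 / 5) := by nlinarith
        have g2 : (1 + lam) ^ 2 ≤ 2 := by nlinarith
        nlinarith [mul_le_mul g1 g2 (sq_nonneg _) (by positivity)]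
      have f4 : 0 ≤ y * (lam - y * (1 - lam ^ 2) / 2 - y ^ 2 * (1 + lam) ^ 2 / 2) :=
        mul_nonneg hy0 (by linarith)
      linarith
    have hy2 : 0 ≤ 1 - y := by linarith
    rw [e1, Real.exp_neg, inv_le_iff_one_le_mul₀ (Real.exp_pos v)]
    have e4 := mul_le_mul_of_nonneg_left e2 hy2
    rw [hy] at *
    linarith
  · have : (lam * 0 - lam ^ 2) * x ≤ 0 := by nlinarith [mul_nonneg (sq_nonneg lam) hx0]
    simpa using Real.exp_le_one_iff.2 this
  · set u := (lam * 1 - lam ^ 2) * x with hu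
    have hc0 : 0 ≤ lam * 1 - lam ^ 2 := by nlinarith
    have hc1 : lam * 1 - lam ^ 2 ≤ lam := by nlinarith [sq_nonneg lam]
    have hu0 : 0 ≤ u := mul_nonneg hc0 hx0
    have hu1 : u ≤ lam * x := mul_le_mul_of_nonneg_right hc1 hx0
    have hlx : lam * x ≤ lam := by nlinarith
    have e1 := Real.abs_exp_sub_one_sub_id_le (x := u) (abs_le.2 ⟨by linarith, by linarith⟩)
    have e2 := (abs_le.1 e1).2
    have e3 : u ^ 2 ≤ lam ^ 2 * x := by nlinarith [mul_nonneg (sq_nonneg lam) hx0]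
    have e4 : u = lam * 1 * x - lam ^ 2 * x := by rw [hu]; ring
    linarith

lemma exp_le_one_add_two_mul {x : ℝ} (hx0 : 0 ≤ x) (hx1 : x ≤ 1) : Real.exp x ≤ 1 + 2 * x := by
  have e1 := Real.abs_exp_sub_one_sub_id_le (x := x) (abs_le.2 ⟨by linarith, hx1⟩)
  have e2 := (abs_le.1 e1).2
  nlinarith

/-- The exponent of the supermartingale that compares arm `b` with arm `c`. -/
def aaeasExponent {k : ℕ} {Ω : Type*} (B : StochasticBandit k) (T : ℕ) (δ : ℝ)
    (r : ℕ → Fin k → Ω → ℝ) (A : ℕ → Ω → Fin k) (c b : Fin k) (lam : ℝ) (t : ℕ) (ω : Ω) : ℝ :=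
  lam * ((aaeasState T δ r A t ω).R b - (aaeasState T δ r A t ω).R c
    + B.gap b * inverseActiveSum T δ r A t ω) - lam ^ 2 * (aaeasState T δ r A t ω).S

/-- The event that both arms are active at the beginning of round `t`. -/
def bothActive {k : ℕ} {Ω : Type*} (T : ℕ) (δ : ℝ) (r : ℕ → Fin k → Ω → ℝ) (A : ℕ → Ω → Fin k)
    (c b : Fin k) (t : ℕ) : Set Ω :=
  {ω | c ∈ (aaeasState T δ r A t ω).active} ∩ {ω | b ∈ (aaeasState T δ r A t ω).active}

/-- The difference of the indicators of the arms `b` and `c`. -/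
def armSign {k : ℕ} (c b a : Fin k) : ℝ := (if b = a then 1 else 0) - (if c = a then 1 else 0)

lemma armSign_mem {k : ℕ} (c b a : Fin k) :
    armSign c b a = -1 ∨ armSign c b a = 0 ∨ armSign c b a = 1 := by
  unfold armSign
  split_ifs <;> norm_num

section Exponent

variable {k : ℕ} {Ω : Type*} {B : StochasticBandit k} {T : ℕ} {δ : ℝ}
  {r : ℕ → Fin k → Ω → ℝ} {A : ℕ → Ω → Fin k} {c b : Fin k} {lam : ℝ}

lemma aaeasExponent_zero (ω : Ω) : aaeasExponent B T δ r A c b lam 0 ω = 0 := by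
  simp [aaeasExponent, aaeasState_zero, inverseActiveSum]

lemma aaeasExponent_succ (t : ℕ) (ω : Ω) : aaeasExponent B T δ r A c b lam (t + 1) ω
    = (aaeasExponent B T δ r A c b lam t ω
        + lam * B.gap b * (1 / ((aaeasState T δ r A t ω).active.card : ℝ)))
      + (lam * armSign c b (A t ω) - lam ^ 2) * playedReward r A t ω := by
  have h : inverseActiveSum T δ r A (t + 1) ω = inverseActiveSum T δ r A t ω
    + 1 / ((aaeasState T δ r A t ω).active.card : ℝ) := Finset.sum_range_succ _ _
  unfold aaeasExponent armSign
  rw [h, aaeasState_succ_R, aaeasState_succ_R, aaeasState_succ_S]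
  split_ifs <;> ring

lemma aaeasExponent_le (hk : 0 < k) (h0 : 0 ≤ lam) (h1 : lam ≤ 2 / 5) (t : ℕ) (ω : Ω) :
    aaeasExponent B T δ r A c b lam t ω ≤ 2 * t := by
  have e1 := aaeas_R_le (T := T) (δ := δ) (r := r) (A := A) ω b t
  have e2 := aaeas_R_nonneg (T := T) (δ := δ) (r := r) (A := A) ω c t
  have e3 := inverseActiveSum_le (T := T) (δ := δ) (r := r) (A := A) hk t ω
  have e4 := inverseActiveSum_nonneg (T := T) (δ := δ) (r := r) (A := A) t ω
  have e5 := B.gap_le_one hk b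
  have e6 := B.gap_nonneg b
  have e7 := mul_nonneg (sq_nonneg lam)
    (aaeas_S_nonneg (T := T) (δ := δ) (r := r) (A := A) ω t)
  have e8 : B.gap b * inverseActiveSum T δ r A t ω ≤ t := by nlinarith
  have e9 : (0 : ℝ) ≤ t := Nat.cast_nonneg t
  unfold aaeasExponent
  have e10 : lam * ((aaeasState T δ r A t ω).R b - (aaeasState T δ r A t ω).R c
    + B.gap b * inverseActiveSum T δ r A t ω) ≤ lam * (2 * t) :=
    mul_le_mul_of_nonneg_left (by linarith) h0
  nlinarith

lemma measurable_aaeasExponent (t : ℕ) :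
    Measurable[pastSigma r A t] (aaeasExponent B T δ r A c b lam t) := by
  have h := measurable_aaeasState (T := T) (δ := δ) (r := r) (A := A) t
  have hW := measurable_inverseActiveSum (T := T) (δ := δ) (r := r) (A := A) t
  unfold aaeasExponent
  exact (measurable_const.mul (((h.R b).sub (h.R c)).add (measurable_const.mul hW))).sub
    (measurable_const.mul h.S)

lemma measurableSet_bothActive (t : ℕ) :
    MeasurableSet[pastSigma r A t] (bothActive T δ r A c b t) := by
  have h := measurable_aaeasState (T := T) (δ := δ) (r := r) (A := A) t
  exact (h.active c).inter (h.active b)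

lemma bothActive_succ_subset (t : ℕ) :
    bothActive T δ r A c b (t + 1) ⊆ bothActive T δ r A c b t := fun ω hω =>
  ⟨((mem_active_succ t ω c).1 hω.1).1, ((mem_active_succ t ω b).1 hω.2).1⟩

open Classical in
/-- On the event that both arms are active, the conditional mean of the increment. -/
lemma sum_prob_mul_armSign (hk : 0 < k) (hc : B.mean c = B.bestMean) {t : ℕ} {ω : Ω}
    (hω : ω ∈ bothActive T δ r A c b t) :
    ∑ a, (AAEAS k T δ).prob ((AAEAS k T δ).stateAt (clippedReward r) A t ω) a
        * (1 + lam * armSign c b a * B.mean a)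
      = 1 - lam * B.gap b * (1 / ((aaeasState T δ r A t ω).active.card : ℝ)) := by
  have h1 := (aaeas_regular (T := T) (δ := δ) (r := r) (A := A) hk).sum_prob t ω
  simp only [mul_add, mul_one, Finset.sum_add_distrib, h1]
  have h2 : ∀ a, (AAEAS k T δ).prob ((AAEAS k T δ).stateAt (clippedReward r) A t ω) a
      * (lam * armSign c b a * B.mean a)
      = (if b = a then lam * (1 / ((aaeasState T δ r A t ω).active.card : ℝ)) * B.mean b else 0)
      - (if c = a then lam * (1 / ((aaeasState T δ r A t ω).active.card : ℝ)) * B.mean c else 0) := by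
    intro a
    rw [aaeas_prob_eq, armSign]
    have hcm : c ∈ (aaeasState T δ r A t ω).active := hω.1
    have hbm : b ∈ (aaeasState T δ r A t ω).active := hω.2
    rcases eq_or_ne b a with hba | hba <;> rcases eq_or_ne c a with hca | hca
    · subst hba
      simp [hca]
    · subst hba
      simp [hca, hbm]
      ring
    · subst hca
      simp [hba, hcm]
      ring
    · simp [hba, hca]
  rw [Finset.sum_congr rfl fun a _ => h2 a, Finset.sum_sub_distrib]
  simp only [Finset.sum_ite_eq, Finset.mem_univ, if_true]
  rw [hc, StochasticBandit.gap]
  ring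

end Exponent

namespace IsRun

variable {k : ℕ} {Ω : Type*} [mΩ : MeasurableSpace Ω] {P : Measure Ω} [IsProbabilityMeasure P]
  {B : StochasticBandit k} {T : ℕ} {δ : ℝ} {r : ℕ → Fin k → Ω → ℝ} {A : ℕ → Ω → Fin k}
  {c b : Fin k} {lam : ℝ}

lemma integrable_aaeas_exp (h : IsRun P B (AAEAS k T δ) T r A) (hk : 0 < k) (h0 : 0 ≤ lam)
    (h1 : lam ≤ 2 / 5) (s t : ℕ) :
    Integrable ((bothActive T δ r A c b s).indicator
      fun ω => Real.exp (aaeasExponent B T δ r A c b lam t ω)) P := by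
  refine Integrable.indicator ?_ (h.pastSigma_le s _ (measurableSet_bothActive s))
  refine Integrable.of_bound (C := Real.exp (2 * t)) (Measurable.aestronglyMeasurable ?_)
    (.of_forall fun ω => ?_)
  · exact ((measurable_aaeasExponent t).mono (h.pastSigma_le t) le_rfl).exp
  · rw [Real.norm_eq_abs, abs_of_pos (Real.exp_pos _)]
    exact Real.exp_le_exp.2 (aaeasExponent_le hk h0 h1 t ω)

/-- When both arms are active they are equally likely, so the drift of `R b - R c` is minus the gap
over the number of active arms, which the term `inverseActiveSum` compensates. Both sides use
activity at `t`: the removal decision after round `t` concerns the arms active at `t` and their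
updated rewards. -/
lemma integral_aaeas_exp_succ_le (h : IsRun P B (AAEAS k T δ) T r A) (hk : 0 < k)
    (hc : B.mean c = B.bestMean) (h0 : 0 ≤ lam) (h1 : lam ≤ 2 / 5) {t : ℕ} (ht : t < T) :
    ∫ ω, (bothActive T δ r A c b t).indicator
        (fun ω => Real.exp (aaeasExponent B T δ r A c b lam (t + 1) ω)) ω ∂P
      ≤ ∫ ω, (bothActive T δ r A c b t).indicator
        (fun ω => Real.exp (aaeasExponent B T δ r A c b lam t ω)) ω ∂P := by
  have hR := aaeas_regular (T := T) (δ := δ) (r := r) (A := A) hk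
  set G : Ω → ℝ := (bothActive T δ r A c b t).indicator fun ω =>
    Real.exp (aaeasExponent B T δ r A c b lam t ω
      + lam * B.gap b * (1 / ((aaeasState T δ r A t ω).active.card : ℝ))) with hG
  have hGm : Measurable[pastSigma r A t] G := by
    refine Measurable.indicator ?_ (measurableSet_bothActive t)
    exact Real.measurable_exp.comp (Measurable.add (measurable_aaeasExponent t)
      (Measurable.mul measurable_const (Measurable.div measurable_const
        (measurable_aaeasState t).card)))
  have hG0 : ∀ ω, 0 ≤ G ω := fun ω => Set.indicator_nonneg (fun _ _ => (Real.exp_pos _).le) ω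
  have hGb : ∀ ω, |G ω| ≤ Real.exp (2 * t + 1) := by
    intro ω
    rw [abs_of_nonneg (hG0 ω), hG]
    refine Set.indicator_apply_le' (fun _ => Real.exp_le_exp.2 (add_le_add
      (aaeasExponent_le hk h0 h1 t ω) ?_)) fun _ => (Real.exp_pos _).le
    have e1 := one_le_card_active (T := T) (δ := δ) (r := r) (A := A) hk t ω
    have e2 : 1 / ((aaeasState T δ r A t ω).active.card : ℝ) ≤ 1 := by
      rw [div_le_one (by linarith)]
      exact e1
    have e3 : 0 ≤ 1 / ((aaeasState T δ r A t ω).active.card : ℝ) := by positivity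
    have e4 := B.gap_nonneg b
    have e5 := B.gap_le_one hk b
    have e6 : lam * B.gap b ≤ 1 := by nlinarith
    have e7 : 0 ≤ lam * B.gap b := mul_nonneg h0 e4
    nlinarith
  set f : Fin k → ℝ → ℝ := fun a x => Real.exp ((lam * armSign c b a - lam ^ 2) * x) with hf
  have hfm : ∀ a, Measurable (f a) := fun a => by simp only [hf]; fun_prop
  have hfle : ∀ a, ∀ x ∈ Set.Icc (0 : ℝ) 1, f a x ≤ 1 + lam * armSign c b a * x :=
    fun a x hx => exp_bernstein_le h0 h1 (armSign_mem c b a) hx.1 hx.2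
  have hfb : ∀ a, ∀ x ∈ Set.Icc (0 : ℝ) 1, |f a x| ≤ 2 := by
    intro a x hx
    rw [abs_of_pos (Real.exp_pos _)]
    refine (hfle a x hx).trans ?_
    rcases armSign_mem c b a with e | e | e <;> rw [e] <;> nlinarith [hx.1, hx.2]
  have hround := h.integral_round ht (hR.measurable_prob t) (g := fun _ => G) (fun _ => hGm)
    (fun _ => hGb) hfm hfb
  have e1 : ∀ ω, (bothActive T δ r A c b t).indicator
      (fun ω => Real.exp (aaeasExponent B T δ r A c b lam (t + 1) ω)) ω
      = G ω * f (A t ω) (clippedReward r t (A t ω) ω) := by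
    intro ω
    by_cases hω : ω ∈ bothActive T δ r A c b t
    · rw [hG, Set.indicator_of_mem hω, Set.indicator_of_mem hω, aaeasExponent_succ, Real.exp_add]
      rfl
    · rw [hG, Set.indicator_of_notMem hω, Set.indicator_of_notMem hω, zero_mul]
  simp only [e1]
  rw [hround]
  have hfint : ∀ a, ∫ x, f a x ∂(B.dist a : Measure ℝ) ≤ 1 + lam * armSign c b a * B.mean a := by
    intro a
    have e2 : ∫ x, (1 + lam * armSign c b a * x) ∂(B.dist a : Measure ℝ)
        = 1 + lam * armSign c b a * B.mean a := by
      rw [integral_add (integrable_const _) ((B.integrable_id a).const_mul _), integral_const_mul]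
      simp [StochasticBandit.mean]
    rw [← e2]
    exact integral_mono_ae (B.integrable_of_bounded a (hfm a) (hfb a))
      ((integrable_const _).add ((B.integrable_id a).const_mul _))
      ((B.supported a).mono fun x hx => hfle a x hx)
  have hGp : ∀ a, Integrable (fun ω => G ω
      * (AAEAS k T δ).prob ((AAEAS k T δ).stateAt (clippedReward r) A t ω) a) P := fun a =>
    (h.integrable_prob hR t a).bdd_mul
      (hGm.mono (h.pastSigma_le t) le_rfl).aestronglyMeasurable (.of_forall hGb)
  refine (Finset.sum_le_sum fun a _ => mul_le_mul_of_nonneg_left (hfint a)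
    (integral_nonneg fun ω => mul_nonneg (hG0 ω) (hR.prob_nonneg t a ω))).trans ?_
  simp only [← integral_mul_const]
  rw [← integral_finsetSum _ fun a _ => (hGp a).mul_const _]
  refine integral_mono (integrable_finsetSum _ fun a _ => (hGp a).mul_const _)
    (h.integrable_aaeas_exp hk h0 h1 t t) fun ω => ?_
  simp only [mul_assoc (G ω), ← Finset.mul_sum]
  by_cases hω : ω ∈ bothActive T δ r A c b t
  · rw [hG, Set.indicator_of_mem hω, Set.indicator_of_mem hω, sum_prob_mul_armSign hk hc hω, Real.exp_add, mul_assoc]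
    -- What remains is `exp y * (1 - y) ≤ 1`.
    refine mul_le_of_le_one_right (Real.exp_pos _).le ?_
    generalize lam * B.gap b * (1 / ((aaeasState T δ r A t ω).active.card : ℝ)) = y
    have e2 := Real.add_one_le_exp (-y)
    have e3 := mul_le_mul_of_nonneg_left e2 (Real.exp_pos y).le
    rw [← Real.exp_add, add_neg_cancel, Real.exp_zero] at e3
    linarith
  · rw [hG, Set.indicator_of_notMem hω, Set.indicator_of_notMem hω, zero_mul]

/-- Removed arms never return, so shrinking the indicator from round `t` to `t + 1` only lowers the
integral. -/
lemma integral_aaeas_exp_le_one (h : IsRun P B (AAEAS k T δ) T r A) (hk : 0 < k)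
    (hc : B.mean c = B.bestMean) (h0 : 0 ≤ lam) (h1 : lam ≤ 2 / 5) :
    ∀ t ≤ T, ∫ ω, (bothActive T δ r A c b t).indicator
        (fun ω => Real.exp (aaeasExponent B T δ r A c b lam t ω)) ω ∂P ≤ 1
  | 0, _ => by
    refine (integral_mono (h.integrable_aaeas_exp hk h0 h1 0 0) (integrable_const 1)
      fun ω => ?_).trans (by simp)
    refine Set.indicator_apply_le' (fun _ => ?_) fun _ => zero_le_one
    rw [aaeasExponent_zero, Real.exp_zero]
  | t + 1, ht => by
    refine le_trans ?_ ((h.integral_aaeas_exp_succ_le hk hc h0 h1 (b := b) ht).trans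
      (integral_aaeas_exp_le_one h hk hc h0 h1 t (by omega)))
    exact integral_mono (h.integrable_aaeas_exp hk h0 h1 _ _) (h.integrable_aaeas_exp hk h0 h1 _ _)
      fun ω => Set.indicator_le_indicator_of_subset (bothActive_succ_subset t)
        (fun _ => (Real.exp_pos _).le) ω

lemma aaeas_comparison_tail (h : IsRun P B (AAEAS k T δ) T r A) (hk : 0 < k)
    (hc : B.mean c = B.bestMean) (h0 : 0 ≤ lam) (h1 : lam ≤ 2 / 5) {t : ℕ} (ht : t < T) (ℓ : ℝ) :
    P.real {ω | ω ∈ bothActive T δ r A c b t ∧ ℓ ≤ aaeasExponent B T δ r A c b lam (t + 1) ω}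
      ≤ Real.exp (-ℓ) := by
  have hmarkov := mul_meas_ge_le_integral_of_nonneg (μ := P)
    (.of_forall fun ω => Set.indicator_nonneg (fun _ _ => (Real.exp_pos _).le) ω)
    (h.integrable_aaeas_exp (c := c) (b := b) (lam := lam) hk h0 h1 t (t + 1)) (Real.exp ℓ)
  have hle := (h.integral_aaeas_exp_succ_le hk hc h0 h1 (b := b) ht).trans
    (h.integral_aaeas_exp_le_one hk hc h0 h1 t ht.le)
  have hsub : P.real {ω | ω ∈ bothActive T δ r A c b t ∧
      ℓ ≤ aaeasExponent B T δ r A c b lam (t + 1) ω}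
      ≤ P.real {ω | Real.exp ℓ ≤ (bothActive T δ r A c b t).indicator
        (fun ω => Real.exp (aaeasExponent B T δ r A c b lam (t + 1) ω)) ω} := by
    refine measureReal_mono fun ω hω => ?_
    have : Real.exp ℓ ≤ (bothActive T δ r A c b t).indicator
        (fun ω => Real.exp (aaeasExponent B T δ r A c b lam (t + 1) ω)) ω := by
      rw [Set.indicator_of_mem hω.1]
      exact Real.exp_le_exp.2 hω.2
    exact this
  rw [Real.exp_neg, ← one_div, le_div_iff₀ (Real.exp_pos ℓ), mul_comm]
  exact (mul_le_mul_of_nonneg_left hsub (Real.exp_pos ℓ).le).trans (hmarkov.trans hle)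

lemma integrable_exp_aaeas_S (h : IsRun P B (AAEAS k T δ) T r A) (t : ℕ) :
    Integrable (fun ω => Real.exp (aaeasState T δ r A t ω).S) P := by
  refine Integrable.of_bound (C := Real.exp t) (Measurable.aestronglyMeasurable ?_)
    (.of_forall fun ω => ?_)
  · exact ((measurable_aaeasState t).S.mono (h.pastSigma_le t) le_rfl).exp
  · rw [Real.norm_eq_abs, abs_of_pos (Real.exp_pos _)]
    exact Real.exp_le_exp.2 (aaeas_S_le ω t)

/-- On `[0,1]` one has `exp x ≤ 1 + 2 x`, so a round multiplies the expectation by at most `exp (2 *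
bestMean)`. -/
lemma integral_exp_aaeas_S_le (h : IsRun P B (AAEAS k T δ) T r A) (hk : 0 < k) :
    ∀ t ≤ T, ∫ ω, Real.exp (aaeasState T δ r A t ω).S ∂P ≤ Real.exp (2 * B.bestMean * t)
  | 0, _ => by simp [aaeasState_zero]
  | t + 1, ht => by
    have ih := integral_exp_aaeas_S_le h hk t (by omega)
    have hR := aaeas_regular (T := T) (δ := δ) (r := r) (A := A) hk
    have hm : Measurable[pastSigma r A t] fun ω => Real.exp (aaeasState T δ r A t ω).S :=
      Real.measurable_exp.comp (measurable_aaeasState t).S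
    have hb : ∀ ω, |Real.exp (aaeasState T δ r A t ω).S| ≤ Real.exp t := fun ω => by
      rw [abs_of_pos (Real.exp_pos _)]
      exact Real.exp_le_exp.2 (aaeas_S_le ω t)
    have hfb : ∀ x ∈ Set.Icc (0 : ℝ) 1, |Real.exp x| ≤ Real.exp 1 := fun x hx => by
      rw [abs_of_pos (Real.exp_pos _)]
      exact Real.exp_le_exp.2 hx.2
    have hround := h.integral_round (t := t) ht (hR.measurable_prob t)
      (g := fun _ ω => Real.exp (aaeasState T δ r A t ω).S) (fun _ => hm) (fun _ => hb)
      (f := fun _ => Real.exp) (fun _ => Real.measurable_exp) (fun _ => hfb)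
    have e1 : ∀ ω, Real.exp (aaeasState T δ r A (t + 1) ω).S
        = Real.exp (aaeasState T δ r A t ω).S * Real.exp (clippedReward r t (A t ω) ω) :=
      fun ω => by rw [aaeasState_succ_S, Real.exp_add]; rfl
    simp only [e1]
    rw [hround]
    have hfint : ∀ a, ∫ x, Real.exp x ∂(B.dist a : Measure ℝ) ≤ Real.exp (2 * B.bestMean) := by
      intro a
      have e2 : ∫ x, (1 + 2 * x) ∂(B.dist a : Measure ℝ) = 1 + 2 * B.mean a := by
        rw [integral_add (integrable_const _) ((B.integrable_id a).const_mul _),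
          integral_const_mul]
        simp [StochasticBandit.mean]
      have e3 := integral_mono_ae (B.integrable_of_bounded a Real.measurable_exp hfb)
        ((integrable_const 1).add ((B.integrable_id a).const_mul 2))
        ((B.supported a).mono fun x hx => exp_le_one_add_two_mul hx.1 hx.2)
      have e4 := Real.add_one_le_exp (2 * B.bestMean)
      have e5 := B.mean_le_bestMean a
      refine e3.trans (le_trans (le_of_eq e2) ?_)
      linarith
    have hGp : ∀ a, Integrable (fun ω => Real.exp (aaeasState T δ r A t ω).S
        * (AAEAS k T δ).prob ((AAEAS k T δ).stateAt (clippedReward r) A t ω) a) P := fun a =>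
      (h.integrable_prob hR t a).bdd_mul
        (hm.mono (h.pastSigma_le t) le_rfl).aestronglyMeasurable (.of_forall hb)
    refine (Finset.sum_le_sum fun a _ => mul_le_mul_of_nonneg_left (hfint a)
      (integral_nonneg fun ω => mul_nonneg (Real.exp_pos _).le (hR.prob_nonneg t a ω))).trans ?_
    rw [← Finset.sum_mul, ← integral_finsetSum _ fun a _ => hGp a]
    simp only [← Finset.mul_sum, hR.sum_prob, mul_one]
    refine (mul_le_mul_of_nonneg_right ih (Real.exp_pos _).le).trans (le_of_eq ?_)
    rw [← Real.exp_add]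
    push_cast
    ring_nf

lemma aaeas_S_tail (h : IsRun P B (AAEAS k T δ) T r A) (hk : 0 < k) {t : ℕ} (ht : t ≤ T) (ℓ : ℝ) :
    P.real {ω | 2 * B.bestMean * t + ℓ ≤ (aaeasState T δ r A t ω).S} ≤ Real.exp (-ℓ) := by
  have hmarkov := mul_meas_ge_le_integral_of_nonneg (μ := P)
    (.of_forall fun ω => (Real.exp_pos _).le)
    (h.integrable_exp_aaeas_S t) (Real.exp (2 * B.bestMean * t + ℓ))
  have hle := h.integral_exp_aaeas_S_le hk t ht
  simp only [Real.exp_le_exp] at hmarkov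
  have h2 := hmarkov.trans hle
  rw [Real.exp_add, mul_assoc] at h2
  have h3 := le_of_mul_le_mul_left (h2.trans_eq (mul_one _).symm) (Real.exp_pos _)
  rw [Real.exp_neg, ← one_div, le_div_iff₀ (Real.exp_pos ℓ), mul_comm]
  exact h3

end IsRun

/-! ### The good event of AAEAS -/

/-- A finite grid of parameters of the exponential supermartingales. -/
def tuning (ℓ : ℝ) (n : ℕ) : ℝ := min (2 / 5) (Real.sqrt (ℓ / (n + 1)))

lemma tuning_nonneg (ℓ : ℝ) (n : ℕ) : 0 ≤ tuning ℓ n :=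
  le_min (by norm_num) (Real.sqrt_nonneg _)

lemma tuning_le (ℓ : ℝ) (n : ℕ) : tuning ℓ n ≤ 2 / 5 := min_le_left _ _

/-- The ideal parameter `√(ℓ/S)` depends on the random `S`; the grid point of index `⌊S⌋₊` replaces
it. The deviation budget is `ℓ = 3/2 * L`. -/
lemma lt_confidenceBound {k : ℕ} (hk : 0 < k) {δ' L S y : ℝ} (hL : L = Real.log (2 / δ'))
    (hL1 : 1 ≤ L) (hS : 0 ≤ S)
    (h : tuning (3 / 2 * L) ⌊S⌋₊ * y - tuning (3 / 2 * L) ⌊S⌋₊ ^ 2 * S < 3 / 2 * L) :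
    y < confidenceBound k δ' S := by
  have hk1 : (1 : ℝ) ≤ k := by exact_mod_cast hk
  rw [confidenceBound, ← hL]
  have hn1 : (⌊S⌋₊ : ℝ) ≤ S := Nat.floor_le hS
  have hn2 : S < ⌊S⌋₊ + 1 := Nat.lt_floor_add_one S
  set n : ℝ := (⌊S⌋₊ : ℝ) with hn
  have hn0 : 0 ≤ n := Nat.cast_nonneg _
  -- When the cap `2/5` is active, `S < n + 1 ≤ 75/8 * L`, so `y < 15/4 * L + 15/4 * L`, which is
  -- below `8 * L`. Otherwise `n + 1` is large compared with `L` and the term `4 * S * L` dominates.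
  by_cases hc : 2 / 5 ≤ Real.sqrt (3 / 2 * L / (n + 1))
  · have ht : tuning (3 / 2 * L) ⌊S⌋₊ = 2 / 5 := min_eq_left hc
    rw [ht] at h
    have h1 := Real.le_sqrt_of_sq_le (x := 4 * L)
      (show (4 * L) ^ 2 ≤ max (4 * S * L) (16 * k * L ^ 2) from
        le_max_of_le_right (by nlinarith [sq_nonneg L]))
    have h2 := (Real.le_sqrt (by norm_num) (by positivity)).1 hc
    rw [le_div_iff₀ (by positivity)] at h2
    linarith
  · rw [not_le] at hc
    have ht : tuning (3 / 2 * L) ⌊S⌋₊ = Real.sqrt (3 / 2 * L / (n + 1)) := min_eq_right hc.le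
    rw [ht] at h
    have hl2 : Real.sqrt (3 / 2 * L / (n + 1)) ^ 2 = 3 / 2 * L / (n + 1) :=
      Real.sq_sqrt (by positivity)
    have hlpos : 0 < Real.sqrt (3 / 2 * L / (n + 1)) := Real.sqrt_pos.2 (by positivity)
    set lam := Real.sqrt (3 / 2 * L / (n + 1))
    have hl3 : lam ^ 2 * (n + 1) = 3 / 2 * L := by rw [hl2]; field_simp
    have hn9 : 75 / 8 * L < n + 1 := by
      have : lam ^ 2 < 4 / 25 := by nlinarith
      nlinarith
    have hy : y < 2 * lam * (n + 1) := by
      have : lam * y < lam * (2 * lam * (n + 1)) := by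
        nlinarith [mul_lt_mul_of_pos_left hn2 (pow_pos hlpos 2)]
      exact lt_of_mul_lt_mul_left this hlpos.le
    have h1 := Real.le_sqrt_of_sq_le (x := lam * (n + 1))
      (show (lam * (n + 1)) ^ 2 ≤ max (4 * S * L) (16 * k * L ^ 2) from
        le_max_of_le_left (by
          have : (lam * (n + 1)) ^ 2 = 3 / 2 * L * (n + 1) := by rw [← hl3]; ring
          rw [this]
          nlinarith))
    linarith

/-- A self-consistent inequality: `w` is bounded by about `√(S L)`, and `S` by a multiple of `w`
plus a term of order `L`. Here `w` stands for the gap times `inverseActiveSum`. -/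
lemma elimination_arith {k : ℕ} (hk : 0 < k) {δ' L S w th D : ℝ} (hL : L = Real.log (2 / δ'))
    (hL1 : 1 ≤ L) (hS : 0 ≤ S) (hD : 0 < D) (hDth : D ≤ th)
    (hw : w ≤ 2 * confidenceBound k δ' S) (hSw : S ≤ 2 * th * (k * w / D) + 3 / 2 * L) :
    w ≤ 172 * k * th * L / D := by
  have hk1 : (1 : ℝ) ≤ k := by exact_mod_cast hk
  have hth : 0 < th := hD.trans_le hDth
  -- With this weight in `√(4 S L) ≤ μ S + L / μ`, the part of the bound proportional to `w` is `w /
  -- 2`; the rest is at most `(64 + 16 + 6) * (k * th * L / D)`, whence `172`.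
  set μ := D / (16 * th * k) with hμ
  have hμ0 : 0 < μ := by positivity
  have hμ1 : μ ≤ 1 := by
    rw [hμ, div_le_one (by positivity)]
    nlinarith
  have e1 : Real.sqrt (max (4 * S * L) (16 * k * L ^ 2)) ≤ (μ * S + L / μ) + 4 * k * L := by
    have hA : 0 ≤ μ * S + L / μ := by positivity
    have hB : 0 ≤ 4 * k * L := by positivity
    refine Real.sqrt_le_iff.2 ⟨by positivity, max_le ?_ ?_⟩
    · have : (μ * S + L / μ) ^ 2 - 4 * S * L = (μ * S - L / μ) ^ 2 := by
        field_simp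
        ring
      nlinarith [sq_nonneg (μ * S - L / μ)]
    · have : 16 * k * L ^ 2 ≤ (4 * k * L) ^ 2 := by nlinarith [sq_nonneg L]
      nlinarith
  rw [confidenceBound, ← hL] at hw
  have e2 : μ * S ≤ w / 8 + 3 / 2 * L := by
    have f1 := mul_le_mul_of_nonneg_left hSw hμ0.le
    have f2 : μ * (2 * th * (k * w / D)) = w / 8 := by
      rw [hμ]
      field_simp
      ring
    nlinarith
  have e3 : L / μ = 16 * (k * th * L / D) := by
    rw [hμ]
    field_simp
  have e4 : k * L ≤ k * th * L / D := by
    rw [le_div_iff₀ hD]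
    nlinarith [mul_le_mul_of_nonneg_left hDth (by positivity : 0 ≤ k * L)]
  have e5 : L ≤ k * L := by nlinarith
  have e6 : 172 * k * th * L / D = 172 * (k * th * L / D) := by ring
  rw [e6]
  linarith

/-- The event on which all the deviation bounds hold. -/
structure AaeasGood {k : ℕ} {Ω : Type*} (B : StochasticBandit k) (T : ℕ) (δ ℓ : ℝ)
    (r : ℕ → Fin k → Ω → ℝ) (A : ℕ → Ω → Fin k) (c : Fin k) (ω : Ω) : Prop where
  comparison : ∀ t < T, ∀ b, ∀ n ≤ T, ω ∈ bothActive T δ r A c b t →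
    aaeasExponent B T δ r A c b (tuning ℓ n) (t + 1) ω < ℓ
  total : ∀ t < T, (aaeasState T δ r A (t + 1) ω).S < 2 * B.bestMean * (t + 1 : ℕ) + ℓ

section Good

variable {k : ℕ} {Ω : Type*} {B : StochasticBandit k} {T : ℕ} {δ L : ℝ}
  {r : ℕ → Fin k → Ω → ℝ} {A : ℕ → Ω → Fin k} {c b : Fin k} {ω : Ω}

lemma AaeasGood.lt_confidenceBound (hg : AaeasGood B T δ (3 / 2 * L) r A c ω) (hk : 0 < k)
    (hL : L = Real.log (2 / (δ / (((k : ℝ) + 1) * T)))) (hL1 : 1 ≤ L) {t : ℕ} (ht : t < T)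
    (hω : ω ∈ bothActive T δ r A c b t) :
    (aaeasState T δ r A (t + 1) ω).R b - (aaeasState T δ r A (t + 1) ω).R c
        + B.gap b * inverseActiveSum T δ r A (t + 1) ω
      < confidenceBound k (δ / (((k : ℝ) + 1) * T)) (aaeasState T δ r A (t + 1) ω).S := by
  have hS := aaeas_S_nonneg (T := T) (δ := δ) (r := r) (A := A) ω (t + 1)
  refine _root_.lt_confidenceBound hk hL hL1 hS (hg.comparison t ht b _ ?_ hω)
  -- The index `⌊S⌋₊` lies in the grid `0, …, T`, as `S ≤ t + 1 ≤ T`.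
  refine (Nat.floor_le_floor (aaeas_S_le ω (t + 1))).trans ?_
  rw [Nat.floor_natCast]
  exact ht

/-- The lead of any active arm over the best arm stays below the confidence bound, so the best arm
is never removed. -/
lemma AaeasGood.mem_active (hg : AaeasGood B T δ (3 / 2 * L) r A c ω) (hk : 0 < k)
    (hL : L = Real.log (2 / (δ / (((k : ℝ) + 1) * T)))) (hL1 : 1 ≤ L) :
    ∀ t ≤ T, c ∈ (aaeasState T δ r A t ω).active
  | 0, _ => Finset.mem_univ _
  | t + 1, ht => by
    have ih := hg.mem_active hk hL hL1 t (by omega)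
    refine (mem_active_succ t ω c).2 ⟨ih, fun b hb => ?_⟩
    have h1 := hg.lt_confidenceBound hk hL hL1 ht (b := b) ⟨ih, hb⟩
    have h2 := mul_nonneg (B.gap_nonneg b)
      (inverseActiveSum_nonneg (T := T) (δ := δ) (r := r) (A := A) (t + 1) ω)
    linarith

/-- Survival of `b` bounds `R c - R b` by the confidence bound, while the deviation bound makes `b`
lag by almost the gap times `inverseActiveSum`. Together they bound the latter by two confidence
bounds. -/
lemma AaeasGood.gap_mul_inverseActiveSum_le (hg : AaeasGood B T δ (3 / 2 * L) r A c ω)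
    (hk : 0 < k) (hL : L = Real.log (2 / (δ / (((k : ℝ) + 1) * T)))) (hL1 : 1 ≤ L)
    (hb : 0 < B.gap b) {t : ℕ} (ht : t ≤ T) (hω : b ∈ (aaeasState T δ r A t ω).active) :
    B.gap b * inverseActiveSum T δ r A t ω ≤ 172 * k * B.bestMean * L / B.gap b := by
  have hth := B.gap_le_bestMean b
  rcases t with _ | t
  · have : inverseActiveSum T δ r A 0 ω = 0 := by simp [inverseActiveSum]
    rw [this, mul_zero]
    have : 0 < B.bestMean := hb.trans_le hth
    positivity
  obtain ⟨hb', hle⟩ := (mem_active_succ t ω b).1 hω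
  have hc := hg.mem_active hk hL hL1 t (by omega)
  have h1 := hg.lt_confidenceBound hk hL hL1 ht (b := b) ⟨hc, hb'⟩
  have h2 := hle c hc
  refine elimination_arith hk hL hL1 (aaeas_S_nonneg ω (t + 1)) hb hth (by linarith) ?_
  have h3 := hg.total t ht
  have h4 := le_inverseActiveSum (T := T) (δ := δ) (r := r) (A := A) hk (t + 1) ω
  have h5 : k * (B.gap b * inverseActiveSum T δ r A (t + 1) ω) / B.gap b
      = k * inverseActiveSum T δ r A (t + 1) ω := by field_simp
  rw [h5]
  have h6 := mul_le_mul_of_nonneg_left h4 (B.bestMean_nonneg hk)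
  linarith

/-- On the good event a suboptimal arm has small total probability. -/
lemma AaeasGood.gap_mul_sum_prob_le (hg : AaeasGood B T δ (3 / 2 * L) r A c ω)
    (hk : 0 < k) (hL : L = Real.log (2 / (δ / (((k : ℝ) + 1) * T)))) (hL1 : 1 ≤ L)
    (hb : 0 < B.gap b) : ∀ t ≤ T, B.gap b * ∑ s ∈ Finset.range t,
      (AAEAS k T δ).prob ((AAEAS k T δ).stateAt (clippedReward r) A s ω) b
        ≤ 172 * k * B.bestMean * L / B.gap b + 1
  | 0, _ => by
    have : 0 < B.bestMean := hb.trans_le (B.gap_le_bestMean b)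
    rw [Finset.range_zero, Finset.sum_empty, mul_zero]
    positivity
  | t + 1, ht => by
    classical
    have ih := hg.gap_mul_sum_prob_le hk hL hL1 hb t (by omega)
    have hR := aaeas_regular (T := T) (δ := δ) (r := r) (A := A) hk
    rw [Finset.sum_range_succ, mul_add]
    -- While `b` is active the bound comes directly from `inverseActiveSum`, with `1` for the
    -- current round; once `b` is removed the sum no longer changes.
    by_cases hω : b ∈ (aaeasState T δ r A t ω).active
    · have h1 := hg.gap_mul_inverseActiveSum_le hk hL hL1 hb (by omega) hω
      have h2 : ∑ s ∈ Finset.range t,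
          (AAEAS k T δ).prob ((AAEAS k T δ).stateAt (clippedReward r) A s ω) b
          ≤ inverseActiveSum T δ r A t ω := by
        refine Finset.sum_le_sum fun s _ => ?_
        rw [aaeas_prob_eq]
        split_ifs
        · exact le_rfl
        · positivity
      have h3 := mul_le_mul_of_nonneg_left h2 hb.le
      have h4 := hR.prob_le_one t b ω
      have h5 := hR.prob_nonneg t b ω
      have h6 := B.gap_le_one hk b
      nlinarith
    · rw [aaeas_prob_eq, if_neg hω, mul_zero, add_zero]
      exact ih

end Good

namespace IsRun

variable {k : ℕ} {Ω : Type*} [mΩ : MeasurableSpace Ω] {P : Measure Ω} [IsProbabilityMeasure P]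
  {B : StochasticBandit k} {T : ℕ} {δ : ℝ} {r : ℕ → Fin k → Ω → ℝ} {A : ℕ → Ω → Fin k}
  {c : Fin k}

/-- The good event fails with small probability; the exceptional set can be taken measurable. -/
lemma exists_aaeas_bad (h : IsRun P B (AAEAS k T δ) T r A) (hk : 0 < k)
    (hc : B.mean c = B.bestMean) (ℓ : ℝ) :
    ∃ S : Set Ω, MeasurableSet S ∧ (∀ ω, ω ∉ S → AaeasGood B T δ ℓ r A c ω) ∧
      P.real S ≤ (T * k * (T + 1) + T) * Real.exp (-ℓ) := by
  set S₁ : ℕ → Fin k → ℕ → Set Ω := fun t b n => {ω | ω ∈ bothActive T δ r A c b t ∧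
    ℓ ≤ aaeasExponent B T δ r A c b (tuning ℓ n) (t + 1) ω} with hS₁
  set S₂ : ℕ → Set Ω := fun t =>
    {ω | 2 * B.bestMean * (t + 1 : ℕ) + ℓ ≤ (aaeasState T δ r A (t + 1) ω).S} with hS₂
  have hm₁ : ∀ t b n, MeasurableSet (S₁ t b n) := fun t b n =>
    (h.pastSigma_le t _ (measurableSet_bothActive t)).inter (measurableSet_le measurable_const
      ((measurable_aaeasExponent (t + 1)).mono (h.pastSigma_le (t + 1)) le_rfl))
  have hm₂ : ∀ t, MeasurableSet (S₂ t) := fun t => measurableSet_le measurable_const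
    ((measurable_aaeasState (t + 1)).S.mono (h.pastSigma_le (t + 1)) le_rfl)
  set I := Finset.range T ×ˢ ((Finset.univ : Finset (Fin k)) ×ˢ Finset.range (T + 1)) with hI
  refine ⟨(⋃ i ∈ I, S₁ i.1 i.2.1 i.2.2) ∪ ⋃ t ∈ Finset.range T, S₂ t,
    (Finset.measurableSet_biUnion _ fun i _ => hm₁ _ _ _).union
      (Finset.measurableSet_biUnion _ fun t _ => hm₂ t), fun ω hω => ?_, ?_⟩
  · rw [Set.mem_union, not_or] at hω
    refine ⟨fun t ht b n hn hb => ?_, fun t ht => ?_⟩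
    · by_contra hcon
      refine hω.1 (Set.mem_biUnion (x := (t, b, n)) ?_ ⟨hb, not_lt.1 hcon⟩)
      simp [hI, ht, hn]
    · by_contra hcon
      exact hω.2 (Set.mem_biUnion (x := t) (Finset.mem_range.2 ht) (not_lt.1 hcon))
  · refine (measureReal_union_le _ _).trans ?_
    rw [add_mul]
    refine add_le_add ?_ ?_
    · refine (measureReal_biUnion_finset_le _ _).trans ?_
      refine (Finset.sum_le_card_nsmul _ _ (Real.exp (-ℓ)) fun i hi => ?_).trans (le_of_eq ?_)
      · have ht : i.1 < T := by
          simp only [hI, Finset.mem_product, Finset.mem_range] at hi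
          exact hi.1
        exact h.aaeas_comparison_tail hk hc (tuning_nonneg _ _) (tuning_le _ _) ht ℓ
      · simp only [hI, Finset.card_product, Finset.card_range, Finset.card_univ, Fintype.card_fin,
          nsmul_eq_mul]
        push_cast
        ring
    · refine (measureReal_biUnion_finset_le _ _).trans ?_
      refine (Finset.sum_le_card_nsmul _ _ (Real.exp (-ℓ)) fun t ht => ?_).trans (le_of_eq ?_)
      · exact h.aaeas_S_tail hk (Finset.mem_range.1 ht) ℓ
      · simp

end IsRun

/-! ### Choice of the confidence level and the regret bound for AAEAS. -/

lemma log_confidence_eq {k T : ℕ} (hT : 2 ≤ T) :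
    Real.log (2 / (1 / (T : ℝ) / (((k : ℝ) + 1) * T)))
      = Real.log (2 * (k + 1)) + 2 * Real.log T := by
  have hT' : (0 : ℝ) < T := by exact_mod_cast (by omega : 0 < T)
  have hk' : (0 : ℝ) < k + 1 := by positivity
  have : 2 / (1 / (T : ℝ) / (((k : ℝ) + 1) * T)) = 2 * (k + 1) * (T : ℝ) ^ 2 := by
    field_simp
  rw [this, Real.log_mul (by positivity) (by positivity), Real.log_pow]
  norm_num

/-- The factor `exp (-L)` pays for the union bound over rounds, arms and grid points; the remaining
`exp (-L / 2)` is at most `1 / T`. This is why the deviation level is `3/2 * L`. -/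
lemma bad_prob_arith {k T : ℕ} (hT : 2 ≤ T) {L : ℝ}
    (hL : L = Real.log (2 * (k + 1)) + 2 * Real.log T) :
    ((T : ℝ) * k * (T + 1) + T) * Real.exp (-(3 / 2 * L)) ≤ 1 / T := by
  have hT' : (2 : ℝ) ≤ T := by exact_mod_cast hT
  have hT0 : (0 : ℝ) < T := by linarith
  have hk0 : (0 : ℝ) ≤ k := Nat.cast_nonneg k
  have hlog0 : 0 ≤ Real.log (2 * ((k : ℝ) + 1)) := Real.log_nonneg (by linarith)
  have e1 : Real.exp (-L) = 1 / (2 * (k + 1) * (T : ℝ) ^ 2) := by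
    have : L = Real.log (2 * (k + 1) * (T : ℝ) ^ 2) := by
      rw [hL, Real.log_mul (x := 2 * ((k : ℝ) + 1)) (by positivity) (by positivity), Real.log_pow]
      norm_num
    rw [this, Real.exp_neg, Real.exp_log (by positivity), one_div]
  have e2 : Real.exp (-(L / 2)) ≤ 1 / T := by
    rw [one_div, ← Real.exp_log hT0, ← Real.exp_neg]
    exact Real.exp_le_exp.2 (by linarith)
  have e3 : Real.exp (-(3 / 2 * L)) = Real.exp (-L) * Real.exp (-(L / 2)) := by
    rw [← Real.exp_add]
    ring_nf
  rw [e3, e1, ← mul_assoc, mul_one_div]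
  have e4 : ((T : ℝ) * k * (T + 1) + T) / (2 * (k + 1) * (T : ℝ) ^ 2) ≤ 1 := by
    rw [div_le_one (by positivity)]
    nlinarith [mul_nonneg hk0 (mul_nonneg hT0.le (by linarith : (0 : ℝ) ≤ T - 1))]
  exact (mul_le_mul_of_nonneg_right e4 (Real.exp_pos _).le).trans (by rw [one_mul]; exact e2)

/-- The regret bound for AAEAS. -/
lemma IsRun.aaeas_pseudoRegret_le {k : ℕ} {Ω : Type*} [MeasurableSpace Ω] {P : Measure Ω}
    [IsProbabilityMeasure P] {B : StochasticBandit k} {T : ℕ}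
    {r : ℕ → Fin k → Ω → ℝ} {A : ℕ → Ω → Fin k} (h : IsRun P B (AAEAS k T (1 / (T : ℝ))) T r A)
    (hk : 0 < k) (hT : 2 ≤ T) :
    pseudoRegret P T r A ≤ (172 * k * (4 * k + 4) + 4)
      * (B.bestMean * ∑ a with 0 < B.gap a, Real.log T / B.gap a) := by
  have hR := aaeas_regular (T := T) (δ := 1 / (T : ℝ)) (r := r) (A := A) hk
  have hT' : (2 : ℝ) ≤ T := by exact_mod_cast hT
  have hT0 : (0 : ℝ) < T := by linarith
  have hlog := half_le_log hT
  obtain ⟨c, hc⟩ := B.exists_mean_eq_bestMean hk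
  set p : ℕ → Fin k → Ω → ℝ := fun t a ω =>
    (AAEAS k T (1 / (T : ℝ))).prob ((AAEAS k T (1 / (T : ℝ))).stateAt (clippedReward r) A t ω) a
    with hp
  have hpi : ∀ t a, Integrable (p t a) P := fun t a => h.integrable_prob hR t a
  have hp0 : ∀ t a ω, 0 ≤ p t a ω := hR.prob_nonneg
  have hpsum : ∀ t ω, ∑ a, p t a ω = 1 := hR.sum_prob
  have hreg : pseudoRegret P T r A ≤ ∫ ω, ∑ a, B.gap a * ∑ t ∈ Finset.range T, p t a ω ∂P := by
    refine (h.pseudoRegret_le hk hR).trans (le_of_eq ?_)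
    rw [integral_finsetSum _ fun a _ => (integrable_finsetSum _ fun t _ => hpi t a).const_mul _,
      Finset.sum_comm]
    refine Finset.sum_congr rfl fun a _ => ?_
    rw [integral_const_mul, integral_finsetSum _ fun t _ => hpi t a, Finset.mul_sum]
    exact Finset.sum_congr rfl fun t _ => mul_comm _ _
  refine hreg.trans ?_
  have hth := B.bestMean_nonneg hk
  set L := Real.log (2 * ((k : ℝ) + 1)) + 2 * Real.log T with hLdef
  have hL : L = Real.log (2 / (1 / (T : ℝ) / (((k : ℝ) + 1) * T))) := (log_confidence_eq hT).symm
  have hk0 : (0 : ℝ) ≤ k := Nat.cast_nonneg k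
  have hlog0 : 0 ≤ Real.log (2 * ((k : ℝ) + 1)) := Real.log_nonneg (by linarith)
  have hL1 : 1 ≤ L := by linarith
  have hLle : L ≤ (4 * k + 4) * Real.log T := by
    have := Real.log_le_sub_one_of_pos (by positivity : 0 < 2 * ((k : ℝ) + 1))
    nlinarith
  obtain ⟨S, hSm, hSgood, hSP⟩ := h.exists_aaeas_bad hk hc (3 / 2 * L)
  have hSP' := hSP.trans (bad_prob_arith hT rfl)
  set M := ∑ a with 0 < B.gap a, (172 * k * B.bestMean * L / B.gap a + 1) with hM
  -- Off the bad set each suboptimal arm obeys its own bound. On it the regret is at most `T *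
  -- bestMean`, which the probability `1 / T` reduces to `bestMean`.
  have hpoint : ∀ ω, ∑ a, B.gap a * ∑ t ∈ Finset.range T, p t a ω
      ≤ M + S.indicator (fun _ => T * B.bestMean) ω := by
    intro ω
    have hM0 : 0 ≤ M := Finset.sum_nonneg fun a ha => by
      have := (Finset.mem_filter.1 ha).2
      positivity
    by_cases hω : ω ∈ S
    · rw [Set.indicator_of_mem hω]
      have e1 : ∑ a, B.gap a * ∑ t ∈ Finset.range T, p t a ω
          ≤ ∑ a, B.bestMean * ∑ t ∈ Finset.range T, p t a ω :=
        Finset.sum_le_sum fun a _ => mul_le_mul_of_nonneg_right (B.gap_le_bestMean a)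
          (Finset.sum_nonneg fun t _ => hp0 t a ω)
      rw [← Finset.mul_sum, Finset.sum_comm] at e1
      simp only [hpsum, Finset.sum_const, Finset.card_range, nsmul_eq_mul, mul_one] at e1
      linarith
    · rw [Set.indicator_of_notMem hω, add_zero, hM, Finset.sum_filter]
      refine Finset.sum_le_sum fun a _ => ?_
      split_ifs with ha
      · exact (hSgood ω hω).gap_mul_sum_prob_le hk hL hL1 ha T le_rfl
      · rw [le_antisymm (not_lt.1 ha) (B.gap_nonneg a), zero_mul]
  have hsumint : Integrable (fun ω => ∑ a, B.gap a * ∑ t ∈ Finset.range T, p t a ω) P :=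
    integrable_finsetSum _ fun a _ => (integrable_finsetSum _ fun t _ => hpi t a).const_mul _
  have hindint : Integrable (S.indicator fun _ : Ω => T * B.bestMean) P :=
    (integrable_const _).indicator hSm
  have hint := integral_mono hsumint ((integrable_const M).add hindint) hpoint
  rw [integral_add' (integrable_const M) hindint, integral_indicator_const _ hSm] at hint
  simp only [integral_const, probReal_univ, smul_eq_mul, one_mul] at hint
  by_cases hne : (Finset.univ.filter fun a => 0 < B.gap a).Nonempty
  swap
  · rw [Finset.not_nonempty_iff_eq_empty] at hne
    rw [hne, Finset.sum_empty, mul_zero, mul_zero]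
    have : ∀ a, B.gap a = 0 := fun a => by
      have ha : a ∉ Finset.univ.filter fun a => 0 < B.gap a := by rw [hne]; simp
      exact le_antisymm (by simpa using ha) (B.gap_nonneg a)
    simp [this]
  obtain ⟨b, hb⟩ := hne
  have hb0 : 0 < B.gap b := (Finset.mem_filter.1 hb).2
  have hsum := B.log_div_gap_le_sum hb0 T
  have e1 : P.real S * (T * B.bestMean) ≤ B.bestMean := by
    have := mul_le_mul_of_nonneg_right hSP' (mul_nonneg hT0.le hth)
    have e : 1 / (T : ℝ) * (T * B.bestMean) = B.bestMean := by field_simp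
    linarith
  -- Since a gap is at most `bestMean` and `log T ≥ 1/2`, additive constants fit into the bound.
  have e2 : ∀ a, 0 < B.gap a → B.bestMean * (Real.log T / B.gap a) ≥ 1 / 2 := by
    intro a ha
    rw [ge_iff_le, mul_div_assoc', le_div_iff₀ ha]
    have := B.gap_le_bestMean a
    nlinarith
  have e3 : M ≤ (172 * k * (4 * k + 4) + 2)
      * (B.bestMean * ∑ a with 0 < B.gap a, Real.log T / B.gap a) := by
    rw [hM, Finset.mul_sum, Finset.mul_sum]
    refine Finset.sum_le_sum fun a ha => ?_
    have ha0 := (Finset.mem_filter.1 ha).2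
    have f1 := e2 a ha0
    have f2 : 172 * k * B.bestMean * L / B.gap a
        ≤ 172 * k * (4 * k + 4) * (B.bestMean * (Real.log T / B.gap a)) := by
      have : 172 * k * (4 * k + 4) * (B.bestMean * (Real.log T / B.gap a))
          = 172 * k * B.bestMean * ((4 * k + 4) * Real.log T) / B.gap a := by ring
      rw [this]
      exact div_le_div_of_nonneg_right (mul_le_mul_of_nonneg_left hLle (by positivity)) ha0.le
    linarith
  have e4 : B.bestMean ≤ 2 * (B.bestMean * ∑ a with 0 < B.gap a, Real.log T / B.gap a) := by
    have f1 := e2 b hb0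
    have f2 := mul_le_mul_of_nonneg_left hsum hth
    have f3 := B.bestMean_le_one hk
    linarith
  linarith

end

theorem mainTheorem3 (k : ℕ) (hk : 0 < k) :
    (∃ C : ℝ, 0 < C ∧
      ∀ (T : ℕ), 2 ≤ T → ∀ (B : StochasticBandit k)
        (Ω : Type*) [MeasurableSpace Ω] (P : Measure Ω) [IsProbabilityMeasure P]
        (r : ℕ → Fin k → Ω → ℝ) (A : ℕ → Ω → Fin k),
        IsRun P B (AAEAS k T (1 / (T : ℝ))) T r A →
        pseudoRegret P T r A ≤
          C * (B.bestMean * ∑ a with 0 < B.gap a, Real.log T / B.gap a)) ∧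
    (∀ η₀ : ℝ, 0 < η₀ → η₀ < 1 → ∃ C : ℝ, 0 < C ∧
      ∀ (T : ℕ), 2 ≤ T → ∀ (B : StochasticBandit k),
        (∃ astar, ∀ a, a ≠ astar → B.mean a < B.mean astar) →
        ∀ (Ω : Type*) [MeasurableSpace Ω] (P : Measure Ω) [IsProbabilityMeasure P]
        (r : ℕ → Fin k → Ω → ℝ) (A : ℕ → Ω → Fin k),
        IsRun P B (BROAD k T η₀) T r A →
        pseudoRegret P T r A ≤
          C * (B.bestMean * ∑ a with 0 < B.gap a, Real.log T / B.gap a)) := by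
  have hk0 : (0 : ℝ) < k := by exact_mod_cast hk
  refine ⟨⟨172 * k * (4 * k + 4) + 4, by positivity, fun T hT B Ω _ P _ r A h =>
    h.aaeas_pseudoRegret_le hk hT⟩, fun η₀ h0 h1 => ?_⟩
  have hη : 0 < 1 - η₀ := by linarith
  exact ⟨4 + 2 * (2 + 6 / (1 - η₀)) * k / η₀ + 48 * (2 + 6 / (1 - η₀)) ^ 2 * k, by positivity,
    fun T hT B huniq Ω _ P _ r A h => h.broad_pseudoRegret_le hk h0 h1 hT huniq⟩
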